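/- A stable marriage instance consists of a set $M$ of $n$ men, a set $W$ of $n$ women, and a preference profile $\succ$ that gives every man a strict total order (list) over $W$ and every woman a strict total order over $M$. Let $\mathrm{DA}(\succ)$ denote the matching found by the men-proposing deferred acceptance algorithm: repeatedly, every currently unmatched man proposes to his favorite woman among those who have not rejected him yet, and every woman tentatively keeps her favorite among her current partner and the new proposers and rejects the others, until no further proposals can be made. Fix a man $m$ (the accomplice) and a woman $w$ (the beneficiary), and let $\mu=\mathrm{DA}(\succ)$. For lists $\succ'_m$ over $W$ and $\succ'_w$ over $M$, let $\mu'=\mathrm{DA}(\succ_{-\{m,w\}},\succ'_m,\succ'_w)$ be the outcome when $m$ and $w$ report these lists and all other agents are truthful. The pair $(\succ'_m,\succ'_w)$ causes no regret if $\mu'(m)=\mu(m)$ or $m$ prefers $\mu'(m)$ to $\mu(m)$ (with respect to $\succ_m$). The pair is an optimal pair manipulation if $\mu'(m)=\mu(m)$ and there is no pair of lists causing no regret whose outcome $\mu''$ satisfies $\mu''(w)\succ_w\mu'(w)$. Theorem. An optimal pair manipulation can be computed in $O(n^5)$ time. That is, there is a random access machine program (unit cost per elementary instruction, words of $O(\log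 n)$ bits) which, for every $n$, every profile $\succ$ on $n$ men and $n$ women (given by its preference lists) and every man $m$ and woman $w$, halts after $O(n^5)$ steps and outputs an optimal pair manipulation $(\succ'_m,\succ'_w)$ for $m$ and $w$. -/

import Mathlib

/-! ## Stable marriage instances and deferred acceptance

There are `n` men and `n` women, both indexed by `Fin n`. -/

namespace StableMarriage

/-- A preference list (a strict total order) over `n` agents: `L k` is the agent in position `k`,
position `0` being the most preferred one. -/
abbrev PrefList (n : ℕ) := Equiv.Perm (Fin n)

/-- `L.Prefers a b`: the agent `a` is strictly preferred to `b`, i.e. `a` comes earlier in `L`. -/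
def PrefList.Prefers {n : ℕ} (L : PrefList n) (a b : Fin n) : Prop :=
  L.symm a < L.symm b

/-- A preference profile: `man i` is the list (of women) of man `i`, and `woman j` is the list
(of men) of woman `j`. -/
structure Profile (n : ℕ) where
  man : Fin n → PrefList n
  woman : Fin n → PrefList n

/-- The profile in which man `m` reports `Lm`, woman `w` reports `Lw`, and all other agents report
as in `P`. -/
def Profile.misreport {n : ℕ} (P : Profile n) (m w : Fin n) (Lm Lw : PrefList n) : Profile n where
  man := Function.update P.man m Lm
  woman := Function.update P.woman w Lw

/-- The most preferred element of `S` according to the list `L` (`none` if `S` is empty). -/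
def favorite {n : ℕ} (L : PrefList n) (S : Finset (Fin n)) : Option (Fin n) :=
  ((List.finRange n).map L).find? (fun a => decide (a ∈ S))

/-- A state of the deferred acceptance algorithm: `held w` is the man whose proposal woman `w` has
tentatively accepted, if any, and `rejected m` is the set of women who have rejected man `m`. -/
structure DAState (n : ℕ) where
  held : Fin n → Option (Fin n)
  rejected : Fin n → Finset (Fin n)

/-- In the beginning nobody is matched and nobody has been rejected. -/
def daInit (n : ℕ) : DAState n where
  held := fun _ => none
  rejected := fun _ => ∅

/-- The woman to whom man `m` proposes in this round: if he is currently unmatched, his favorite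
woman among those who have not rejected him yet. -/
def proposal {n : ℕ} (P : Profile n) (s : DAState n) (m : Fin n) : Option (Fin n) :=
  if ∀ w, s.held w ≠ some m then favorite (P.man m) (s.rejected m)ᶜ else none

/-- The men woman `w` chooses from in this round: the man she currently holds and the men who
propose to her. -/
def suitors {n : ℕ} (P : Profile n) (s : DAState n) (w : Fin n) : Finset (Fin n) :=
  Finset.univ.filter (fun m => s.held w = some m ∨ proposal P s m = some w)

/-- One proposal phase followed by one rejection phase: every woman keeps her favorite suitor and
rejects all the others. -/
def daRound {n : ℕ} (P : Profile n) (s : DAState n) : DAState n where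
  held := fun w => favorite (P.woman w) (suitors P s w)
  rejected := fun m => s.rejected m ∪ Finset.univ.filter
    (fun w => m ∈ suitors P s w ∧ favorite (P.woman w) (suitors P s w) ≠ some m)

/-- The state in which deferred acceptance terminates. By `daFinal_proposal` below, no further
proposals are made after `n * n + n` rounds (and a round without proposals changes nothing, see
`daRound_eq_self`). -/
def daFinal {n : ℕ} (P : Profile n) : DAState n :=
  (daRound P)^[n * n + n] (daInit n)

theorem favorite_mem {n : ℕ} {L : PrefList n} {S : Finset (Fin n)} {a : Fin n}
    (h : favorite L S = some a) : a ∈ S := by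
  have := List.find?_some h
  simpa using this

theorem favorite_ne_none {n : ℕ} {L : PrefList n} {S : Finset (Fin n)} {a : Fin n}
    (h : a ∈ S) : favorite L S ≠ none := by
  intro h0
  unfold favorite at h0
  rw [List.find?_eq_none] at h0
  have := h0 a (by simpa using ⟨L.symm a, by simp⟩)
  simp [h] at this

/-- Invariants of the execution. -/
structure DAInv {n : ℕ} (s : DAState n) : Prop where
  inj : ∀ w w' m, s.held w = some m → s.held w' = some m → w = w'
  held_rej : ∀ w m, s.held w = some m → w ∉ s.rejected m
  rej_held : ∀ w m, w ∈ s.rejected m → s.held w ≠ none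

theorem mem_suitors {n : ℕ} {P : Profile n} {s : DAState n} {w m : Fin n} :
    m ∈ suitors P s w ↔ s.held w = some m ∨ proposal P s m = some w := by
  simp [suitors]

theorem proposal_spec {n : ℕ} {P : Profile n} {s : DAState n} {w m : Fin n}
    (h : proposal P s m = some w) : (∀ w', s.held w' ≠ some m) ∧ w ∉ s.rejected m := by
  unfold proposal at h
  split_ifs at h with h1
  exact ⟨h1, by simpa using favorite_mem h⟩

theorem daInv_init (n : ℕ) : DAInv (daInit n) :=
  ⟨by simp [daInit], by simp [daInit], by simp [daInit]⟩

theorem daInv_round {n : ℕ} (P : Profile n) {s : DAState n} (hs : DAInv s) :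
    DAInv (daRound P s) := by
  refine ⟨?_, ?_, ?_⟩
  · intro w w' m h h'
    rcases mem_suitors.1 (favorite_mem h) with h1 | h1 <;>
      rcases mem_suitors.1 (favorite_mem h') with h2 | h2
    · exact hs.inj _ _ _ h1 h2
    · exact absurd h1 ((proposal_spec h2).1 _)
    · exact absurd h2 ((proposal_spec h1).1 _)
    · exact Option.some.inj (h1.symm.trans h2)
  · intro w m h hr
    simp only [daRound, Finset.mem_union, Finset.mem_filter, Finset.mem_univ, true_and] at hr h
    rcases hr with hr | hr
    · rcases mem_suitors.1 (favorite_mem h) with h1 | h1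
      · exact hs.held_rej _ _ h1 hr
      · exact (proposal_spec h1).2 hr
    · exact hr.2 h
  · intro w m hr
    simp only [daRound, Finset.mem_union, Finset.mem_filter, Finset.mem_univ, true_and] at hr ⊢
    rcases hr with hr | hr
    · obtain ⟨m', hm'⟩ := Option.ne_none_iff_exists'.1 (hs.rej_held _ _ hr)
      exact favorite_ne_none (mem_suitors.2 (Or.inl hm'))
    · exact favorite_ne_none hr.1

/-- A state in which a man is unmatched has a woman who holds nobody, and so that man proposes. -/
theorem exists_proposal {n : ℕ} (P : Profile n) {s : DAState n} (hs : DAInv s) {w₀ : Fin n}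
    (h₀ : s.held w₀ = none) : ∃ m w, proposal P s m = some w := by
  classical
  have hfree : ∃ m, ∀ w, s.held w ≠ some m := by
    by_contra! hcon
    choose g hg using hcon
    have hgi : Function.Injective g := by
      intro a b hab
      have h1 := hg a
      rw [hab, hg b] at h1
      exact (Option.some.inj h1).symm
    obtain ⟨a, ha⟩ := Finite.injective_iff_surjective.1 hgi w₀
    have := hg a
    rw [ha, h₀] at this
    cases this
  obtain ⟨m, hm⟩ := hfree
  have hw : w₀ ∈ (s.rejected m)ᶜ := by
    rw [Finset.mem_compl]
    exact fun h => hs.rej_held _ _ h h₀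
  obtain ⟨w, hw⟩ := Option.ne_none_iff_exists'.1 (favorite_ne_none (L := P.man m) hw)
  exact ⟨m, w, by simp [proposal, hm, hw]⟩

/-- A measure of progress: the number of rejections so far plus the number of matched women. -/
def daProgress {n : ℕ} (s : DAState n) : ℕ :=
  ∑ m, (s.rejected m).card + (Finset.univ.filter (fun w => s.held w ≠ none)).card

theorem held_mono {n : ℕ} (P : Profile n) (s : DAState n) {w : Fin n} (h : s.held w ≠ none) :
    (daRound P s).held w ≠ none := by
  obtain ⟨m', hm'⟩ := Option.ne_none_iff_exists'.1 h
  exact favorite_ne_none (mem_suitors.2 (Or.inl hm'))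

theorem daProgress_lt {n : ℕ} (P : Profile n) {s : DAState n} (hs : DAInv s) {m w : Fin n}
    (hp : proposal P s m = some w) : daProgress s < daProgress (daRound P s) := by
  have hsub : ∀ a, s.rejected a ⊆ (daRound P s).rejected a :=
    fun a => Finset.subset_union_left
  have hsub' : Finset.univ.filter (fun w => s.held w ≠ none) ⊆
      Finset.univ.filter (fun w => (daRound P s).held w ≠ none) := by
    intro a ha
    simp only [Finset.mem_filter, Finset.mem_univ, true_and] at ha ⊢
    exact held_mono P s ha
  -- a new rejection by `w` of a suitor `a`
  have key : ∀ a, a ∈ suitors P s w → (daRound P s).held w ≠ some a → w ∉ s.rejected a →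
      daProgress s < daProgress (daRound P s) := by
    intro a ha hne hnot
    refine add_lt_add_of_lt_of_le (Finset.sum_lt_sum (fun b _ => Finset.card_le_card (hsub b))
      ⟨a, Finset.mem_univ a, Finset.card_lt_card ⟨hsub a, fun h => hnot (h ?_)⟩⟩)
      (Finset.card_le_card hsub')
    simp only [daRound, Finset.mem_union, Finset.mem_filter, Finset.mem_univ, true_and]
    exact Or.inr ⟨ha, hne⟩
  have hmS : m ∈ suitors P s w := mem_suitors.2 (Or.inr hp)
  by_cases hm : (daRound P s).held w = some m
  · cases hw : s.held w with
    | none =>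
      refine add_lt_add_of_le_of_lt (Finset.sum_le_sum fun b _ => Finset.card_le_card (hsub b))
        (Finset.card_lt_card ⟨hsub', fun h => ?_⟩)
      have : w ∈ Finset.univ.filter (fun w => s.held w ≠ none) := h (by simp [hm])
      simp [hw] at this
    | some a =>
      have hne : a ≠ m := fun h => (proposal_spec hp).1 w (h ▸ hw)
      exact key a (mem_suitors.2 (Or.inl hw)) (fun h => hne (Option.some.inj (h.symm.trans hm)))
        (hs.held_rej _ _ hw)
  · exact key m hmS hm (proposal_spec hp).2

theorem daInv_iterate {n : ℕ} (P : Profile n) (k : ℕ) :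
    DAInv ((daRound P)^[k] (daInit n)) := by
  induction k with
  | zero => exact daInv_init n
  | succ k ih => rw [Function.iterate_succ_apply']; exact daInv_round P ih

theorem daProgress_iterate {n : ℕ} (P : Profile n) (k : ℕ) :
    (∀ w, ((daRound P)^[k] (daInit n)).held w ≠ none) ∨
      k ≤ daProgress ((daRound P)^[k] (daInit n)) := by
  induction k with
  | zero => exact Or.inr (Nat.zero_le _)
  | succ k ih =>
    rw [Function.iterate_succ_apply']
    by_cases hall : ∀ w, ((daRound P)^[k] (daInit n)).held w ≠ none
    · exact Or.inl fun w => held_mono P _ (hall w)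
    · push Not at hall
      obtain ⟨w₀, hw₀⟩ := hall
      obtain ⟨m, w, hp⟩ := exists_proposal P (daInv_iterate P k) hw₀
      have h1 := daProgress_lt P (daInv_iterate P k) hp
      rcases ih with h | h
      · exact absurd hw₀ (h w₀)
      · right; omega

theorem daFinal_held_ne_none {n : ℕ} (P : Profile n) (w : Fin n) :
    (daFinal P).held w ≠ none := by
  rcases daProgress_iterate P (n * n + n) with h | h
  · exact h w
  · intro hw
    change n * n + n ≤ daProgress (daFinal P) at h
    have h1 : ∑ m, ((daFinal P).rejected m).card ≤ n * n := by
      calc _ ≤ ∑ _m : Fin n, n :=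
            Finset.sum_le_sum fun m _ => (Finset.card_le_univ _).trans (by simp)
        _ = n * n := by simp
    have h2 : (Finset.univ.filter (fun w => (daFinal P).held w ≠ none)).card <
        (Finset.univ : Finset (Fin n)).card :=
      Finset.card_lt_card (Finset.filter_ssubset.2 ⟨w, Finset.mem_univ w, by simp [hw]⟩)
    rw [Finset.card_univ, Fintype.card_fin] at h2
    unfold daProgress at h
    omega

theorem daFinal_get_bijective {n : ℕ} (P : Profile n) : Function.Bijective
    (fun w => ((daFinal P).held w).get (Option.isSome_iff_ne_none.2 (daFinal_held_ne_none P w))) := by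
  rw [← Finite.injective_iff_bijective]
  intro w w' h
  have hw := Option.some_get (Option.isSome_iff_ne_none.2 (daFinal_held_ne_none P w))
  have hw' := Option.some_get (Option.isSome_iff_ne_none.2 (daFinal_held_ne_none P w'))
  dsimp only at h
  rw [h] at hw
  exact (daInv_iterate P (n * n + n)).inj w w' _ hw.symm hw'.symm

/-- The matching computed by the (men-proposing) deferred acceptance algorithm: `DA P m` is the
woman matched to man `m`, and `(DA P).symm w` is the man matched to woman `w`, i.e. the man whom
`w` holds when the algorithm terminates (see `daFinal_held`). -/
noncomputable def DA {n : ℕ} (P : Profile n) : Fin n ≃ Fin n :=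
  (Equiv.ofBijective _ (daFinal_get_bijective P)).symm

theorem daFinal_held {n : ℕ} (P : Profile n) (w : Fin n) :
    (daFinal P).held w = some ((DA P).symm w) := by
  simp [DA]

theorem daFinal_proposal {n : ℕ} (P : Profile n) (m : Fin n) :
    proposal P (daFinal P) m = none := by
  unfold proposal
  rw [if_neg]
  push Not
  exact ⟨DA P m, by simp [daFinal_held]⟩

theorem daRound_eq_self {n : ℕ} (P : Profile n) (s : DAState n)
    (h : ∀ m, proposal P s m = none) : daRound P s = s := by
  have hs : ∀ w, favorite (P.woman w) (suitors P s w) = s.held w := by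
    intro w
    cases hw : s.held w with
    | none =>
      by_contra hne
      obtain ⟨a, ha⟩ := Option.ne_none_iff_exists'.1 hne
      rcases mem_suitors.1 (favorite_mem ha) with h1 | h1
      · simp [hw] at h1
      · simp [h] at h1
    | some b =>
      obtain ⟨a, ha⟩ := Option.ne_none_iff_exists'.1
        (favorite_ne_none (L := P.woman w) (mem_suitors.2 (Or.inl hw) : b ∈ suitors P s w))
      rcases mem_suitors.1 (favorite_mem ha) with h1 | h1
      · rw [ha, ← h1, hw]
      · simp [h] at h1
  cases s with
  | mk held rejected =>
    simp only [daRound, DAState.mk.injEq]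
    refine ⟨funext hs, funext fun m => ?_⟩
    rw [Finset.union_eq_left]
    intro w hw
    simp only [Finset.mem_filter, Finset.mem_univ, true_and] at hw
    rcases mem_suitors.1 hw.1 with h1 | h1
    · exact absurd ((hs w).trans h1) hw.2
    · simp [h] at h1

/-- Man `m` has no regret when the pair `(m, w)` reports `(Lm, Lw)` instead of the true lists:
judged by his true list, his partner does not get worse. -/
def NoRegret {n : ℕ} (P : Profile n) (m w : Fin n) (Lm Lw : PrefList n) : Prop :=
  (P.man m).Prefers (DA (P.misreport m w Lm Lw) m) (DA P m) ∨
    DA (P.misreport m w Lm Lw) m = DA P m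

/-- `(Lm, Lw)` is an optimal pair manipulation of the accomplice `m` and the beneficiary `w`: man
`m` keeps his true partner, and no pair of misreports without regret for `m` yields a
partner whom `w` strictly prefers according to her true list. -/
def IsOptimalPairManipulation {n : ℕ} (P : Profile n) (m w : Fin n) (Lm Lw : PrefList n) : Prop :=
  DA (P.misreport m w Lm Lw) m = DA P m ∧
    ∀ Lm' Lw' : PrefList n, NoRegret P m w Lm' Lw' →
      ¬ (P.woman w).Prefers ((DA (P.misreport m w Lm' Lw')).symm w)
        ((DA (P.misreport m w Lm Lw)).symm w)

end StableMarriage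

/-! ## The word RAM

A random access machine with registers and finitely many randomly accessible arrays of words. Its
programs are structured (sequencing, branching, looping). Every elementary instruction and every
evaluation of a test costs one step. Words are natural numbers below a bound `B`; an instruction
whose result does not fit into a word cannot be executed. -/

namespace WordRAM

/-- `reg x` is the content of register `x`, and `mem a i` is cell `i` of array `a`. -/
structure State where
  reg : ℕ → ℕ
  mem : ℕ → ℕ → ℕ

/-- Elementary instructions. Registers and arrays are named by literals in the program; the cell
accessed by `load` and `store` is given by the content of a register. -/
inductive Instr where
  /-- `x := c` -/
  | const (x c : ℕ)
  /-- `x := y` -/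
  | copy (x y : ℕ)
  /-- `x := y + z` -/
  | add (x y z : ℕ)
  /-- `x := max (y - z) 0` -/
  | sub (x y z : ℕ)
  /-- `x := y * z` -/
  | mul (x y z : ℕ)
  /-- `x := a[y]` -/
  | load (x a y : ℕ)
  /-- `a[y] := x` -/
  | store (a y x : ℕ)

/-- The word that an instruction writes. -/
def Instr.result (s : State) : Instr → ℕ
  | .const _ c => c
  | .copy _ y => s.reg y
  | .add _ y z => s.reg y + s.reg z
  | .sub _ y z => s.reg y - s.reg z
  | .mul _ y z => s.reg y * s.reg z
  | .load _ a y => s.mem a (s.reg y)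
  | .store _ _ x => s.reg x

/-- The state after writing the word `v` into register `x`. -/
def State.setReg (s : State) (x v : ℕ) : State :=
  { s with reg := Function.update s.reg x v }

/-- The state after writing the word `v` into cell `i` of array `a`. -/
def State.setMem (s : State) (a i v : ℕ) : State :=
  { s with mem := Function.update s.mem a (Function.update (s.mem a) i v) }

/-- The state after executing an instruction. -/
def Instr.exec (s : State) (i : Instr) : State :=
  match i with
  | .const x _ | .copy x _ | .add x _ _ | .sub x _ _ | .mul x _ _ | .load x _ _ =>
    s.setReg x (i.result s)
  | .store a y _ => s.setMem a (s.reg y) (i.result s)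

/-- Comparisons of the contents of two registers. -/
inductive Test where
  | lt (x y : ℕ)
  | le (x y : ℕ)
  | eq (x y : ℕ)
  | ne (x y : ℕ)

/-- The outcome of a comparison. -/
def Test.Holds (s : State) : Test → Prop
  | .lt x y => s.reg x < s.reg y
  | .le x y => s.reg x ≤ s.reg y
  | .eq x y => s.reg x = s.reg y
  | .ne x y => s.reg x ≠ s.reg y

/-- Programs. -/
inductive Prog where
  | skip
  | instr (i : Instr)
  | seq (p q : Prog)
  | branch (b : Test) (p q : Prog)
  | loop (b : Test) (p : Prog)

/-- `Exec B p s t s'`: on words below `B`, the program `p` started in state `s` halts after exactly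
`t` steps in state `s'`. -/
inductive Exec (B : ℕ) : Prog → State → ℕ → State → Prop
  | skip (s : State) : Exec B .skip s 0 s
  | instr (i : Instr) (s : State) (h : i.result s < B) : Exec B (.instr i) s 1 (i.exec s)
  | seq {p q : Prog} {s s' s'' : State} {t t' : ℕ} (hp : Exec B p s t s')
      (hq : Exec B q s' t' s'') : Exec B (.seq p q) s (t + t') s''
  | branch_true {b : Test} {p q : Prog} {s s' : State} {t : ℕ} (hb : b.Holds s)
      (hp : Exec B p s t s') : Exec B (.branch b p q) s (t + 1) s'
  | branch_false {b : Test} {p q : Prog} {s s' : State} {t : ℕ} (hb : ¬ b.Holds s)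
      (hq : Exec B q s t s') : Exec B (.branch b p q) s (t + 1) s'
  | loop_true {b : Test} {p : Prog} {s s' s'' : State} {t t' : ℕ} (hb : b.Holds s)
      (hp : Exec B p s t s') (hl : Exec B (.loop b p) s' t' s'') :
      Exec B (.loop b p) s (t + t' + 1) s''
  | loop_false {b : Test} {p : Prog} {s : State} (hb : ¬ b.Holds s) :
      Exec B (.loop b p) s 1 s

end WordRAM

/-! ## Input and output -/

namespace StableMarriage

/-- The initial state for a profile `P`, an accomplice `m` and a beneficiary `w`: registers `0`, `1`
and `2` hold `n`, `m` and `w`; arrays `0` and `1` hold the preference lists of the men and of the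
women, one after the other, so that cell `n * i + k` holds the agent in position `k` of the list of
agent `i`. Everything else is `0`. -/
def inputState {n : ℕ} (P : Profile n) (m w : Fin n) : WordRAM.State where
  reg
    | 0 => n
    | 1 => m
    | 2 => w
    | _ => 0
  mem
    | 0 => fun c => if h : c < n * n then
        (P.man (Fin.divNat ⟨c, h⟩) (Fin.modNat ⟨c, h⟩) : ℕ) else 0
    | 1 => fun c => if h : c < n * n then
        (P.woman (Fin.divNat ⟨c, h⟩) (Fin.modNat ⟨c, h⟩) : ℕ) else 0
    | _ => fun _ => 0

/-- Array `a` holds the preference list `L` in its first `n` cells. -/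
def HoldsList {n : ℕ} (s : WordRAM.State) (a : ℕ) (L : PrefList n) : Prop :=
  ∀ k : Fin n, s.mem a k = L k

end StableMarriage

/-!
# Optimal pair manipulations of deferred acceptance

Deferred acceptance finds the man-optimal stable matching (`DA_manOptimal`), and everything about
manipulations is derived from this characterization. Its main consequence is that no rotation leads
upwards from the man-optimal stable matching (`ManOptimal.no_rotation`), which gives the blocking lemma
(`ManOptimal.exists_blocking`) and strategyproofness for the men (`ManOptimal.strategyproof`).

Let `a` be the true partner of the accomplice `m`.

* A manipulation without regret that improves the partner of the beneficiary `w` leaves `m` his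
  partner `a` (`NoRegret.partner_eq`): if `m` got a better partner, the blocking lemma would provide a
  blocking pair of truthful agents. So only manipulations that keep `a` matter.
* If `m` keeps `a` and `w` gets `b`, then `m` may as well report a list that starts with `x, a` for some
  woman `x` (`exists_simple_man_list`). By strategyproofness `m` gets `a` from each list `x, a, …` with `x`
  above `a` in his report, and the original outcome is the join of the outcomes for all these `x` in
  the lattice of stable matchings; hence one of them already matches `w` with `b`.
* Then `w` may as well report a list that starts with `b, c` for some man `c`
  (`exists_simple_woman_list`), for which the outcome does not change at all: a different outcome would
  expose a rotation.

This leaves `n ^ 3` candidates `(x, b, c)`. For each of them, deferred acceptance with one proposal at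
a time takes `O(n ^ 2)` steps on a word RAM with precomputed positions in the lists of the women, since
every iteration of its main loop makes one of the at most `n ^ 2` proposals. The search
(`WordRAM.mainProg`) keeps the best candidate that leaves `m` his partner. All words that occur are
at most `n ^ 2 + n`.

Programs are verified with the judgment `WordRAM.Runs`, which bounds the number of steps and specifies
the final state. That a program changes only the registers and arrays into which its text writes
(`WordRAM.Exec.frame`) is proved once for all programs.
-/

namespace StableMarriage

variable {n : ℕ}

/-! ### Stable matchings -/

/-- The matching `μ` is stable: a woman whom man `i` prefers to his partner prefers her own partner
to `i`. Preferences are compared through positions in the lists. -/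
def Stable (P : Profile n) (μ : Fin n ≃ Fin n) : Prop :=
  ∀ i j, (P.man i).symm j < (P.man i).symm (μ i) →
    (P.woman j).symm (μ.symm j) < (P.woman j).symm i

/-- The matching `μ` is stable, and each man likes it at least as much as every stable matching. -/
def ManOptimal (P : Profile n) (μ : Fin n ≃ Fin n) : Prop :=
  Stable P μ ∧ ∀ ν, Stable P ν → ∀ i, (P.man i).symm (μ i) ≤ (P.man i).symm (ν i)

theorem ManOptimal.unique {P : Profile n} {μ ν : Fin n ≃ Fin n} (h : ManOptimal P μ)
    (h' : ManOptimal P ν) : μ = ν := by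
  ext i
  exact congrArg _ ((P.man i).symm.injective (le_antisymm (h.2 ν h'.1 i) (h'.2 μ h.1 i)))

theorem favorite_le {L : PrefList n} {S : Finset (Fin n)} {a b : Fin n}
    (h : favorite L S = some a) (hb : b ∈ S) : L.symm a ≤ L.symm b := by
  unfold favorite at h
  rw [List.find?_eq_some_iff_getElem] at h
  obtain ⟨-, k, hk, rfl, hlt⟩ := h
  by_contra! hcon
  simp only [List.getElem_map, List.getElem_finRange, Equiv.symm_apply_apply] at hcon
  have := hlt (L.symm b) (by simpa [Fin.lt_def] using hcon)
  simp [hb] at this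

/-- A suitor of `j` has been rejected by every woman whom he prefers to `j`, provided this holds for
the men whom the women currently hold. -/
theorem mem_rejected_of_mem_suitors {P : Profile n} {s : DAState n}
    (hs : ∀ i j, s.held j = some i → ∀ j', (P.man i).symm j' < (P.man i).symm j →
      j' ∈ s.rejected i)
    {i j : Fin n} (h : i ∈ suitors P s j) {j' : Fin n}
    (hj : (P.man i).symm j' < (P.man i).symm j) : j' ∈ s.rejected i := by
  rcases mem_suitors.1 h with h | h
  · exact hs i j h j' hj
  · unfold proposal at h
    split_ifs at h
    by_contra hcon
    exact absurd (favorite_le h (Finset.mem_compl.2 hcon)) (not_le.2 hj)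

/-- Invariants of deferred acceptance that relate it to stable matchings: a woman who has rejected a
man holds a better one, a man who is held has been rejected by all women above, and no stable matching
pairs a man with a woman who has rejected him. -/
structure DAStableInv (P : Profile n) (s : DAState n) : Prop where
  better : ∀ i j, j ∈ s.rejected i →
    ∃ i', s.held j = some i' ∧ (P.woman j).symm i' < (P.woman j).symm i
  above : ∀ i j, s.held j = some i → ∀ j', (P.man i).symm j' < (P.man i).symm j →
    j' ∈ s.rejected i
  unstable : ∀ i j, j ∈ s.rejected i → ∀ ν, Stable P ν → ν i ≠ j

theorem daStableInv_round {P : Profile n} {s : DAState n} (hs : DAStableInv P s) :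
    DAStableInv P (daRound P s) := by
  refine ⟨?_, ?_, ?_⟩
  · intro i j h
    simp only [daRound, Finset.mem_union, Finset.mem_filter, Finset.mem_univ, true_and] at h ⊢
    rcases h with h | ⟨h, hne⟩
    · obtain ⟨i', hi', hlt⟩ := hs.better i j h
      have hmem : i' ∈ suitors P s j := mem_suitors.2 (Or.inl hi')
      obtain ⟨a, ha⟩ := Option.ne_none_iff_exists'.1 (favorite_ne_none (L := P.woman j) hmem)
      exact ⟨a, ha, (favorite_le ha hmem).trans_lt hlt⟩
    · obtain ⟨a, ha⟩ := Option.ne_none_iff_exists'.1 (favorite_ne_none (L := P.woman j) h)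
      refine ⟨a, ha, (favorite_le ha h).lt_of_ne fun heq => hne ?_⟩
      rw [ha, (P.woman j).symm.injective heq]
  · intro i j h j' hj
    exact Finset.mem_union_left _ (mem_rejected_of_mem_suitors hs.above (favorite_mem h) hj)
  · intro i j h ν hν heq
    simp only [daRound, Finset.mem_union, Finset.mem_filter, Finset.mem_univ, true_and] at h
    rcases h with h | ⟨h, hne⟩
    · exact hs.unstable i j h ν hν heq
    · obtain ⟨a, ha⟩ := Option.ne_none_iff_exists'.1 (favorite_ne_none (L := P.woman j) h)
      have hai : a ≠ i := fun h => hne (h ▸ ha)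
      -- `ν` cannot give `a` anything better than `j`, so `a` and `j` block `ν`
      have h1 : (P.man a).symm j < (P.man a).symm (ν a) := by
        refine lt_of_le_of_ne (not_lt.1 fun hlt => ?_) fun h => hai ?_
        · exact hs.unstable a _ (mem_rejected_of_mem_suitors hs.above (favorite_mem ha) hlt) ν hν rfl
        · exact ν.injective (heq ▸ ((P.man a).symm.injective h).symm)
      have h2 := hν a j h1
      rw [← heq, Equiv.symm_apply_apply, heq] at h2
      exact absurd (favorite_le ha h) (not_le.2 h2)

theorem DA_manOptimal (P : Profile n) : ManOptimal P (DA P) := by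
  have hinv : DAStableInv P (daFinal P) := by
    unfold daFinal
    generalize n * n + n = k
    induction k with
    | zero => exact ⟨by simp [daInit], by simp [daInit], by simp [daInit]⟩
    | succ k ih => rw [Function.iterate_succ_apply']; exact daStableInv_round ih
  have hheld : ∀ i, (daFinal P).held (DA P i) = some i := fun i => by simp [daFinal_held]
  refine ⟨fun i j h => ?_, fun ν hν i => not_lt.1 fun h => ?_⟩
  · obtain ⟨i', hi', hlt⟩ := hinv.better i j (hinv.above i _ (hheld i) j h)
    rw [daFinal_held] at hi'
    rwa [Option.some.inj hi']
  · exact hinv.unstable i _ (hinv.above i _ (hheld i) _ h) ν hν rfl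

theorem ManOptimal.eq_DA {P : Profile n} {μ : Fin n ≃ Fin n} (h : ManOptimal P μ) : DA P = μ :=
  (DA_manOptimal P).unique h

/-- No rotation leads upwards from the man-optimal stable matching `μ`. Otherwise, if every woman
`z` of a set `V` has an admirer (a man preferring her to his partner) and the partners of the
favorite admirers `f z` are again in `V`, then a cycle of `z ↦ μ (f z)` could be improved by
matching each `z` on it with `f z`. -/
theorem ManOptimal.no_rotation {P : Profile n} {μ : Fin n ≃ Fin n} (h : ManOptimal P μ)
    (f : Fin n → Fin n) (V : Finset (Fin n)) (hV : V.Nonempty)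
    (hf : ∀ z ∈ V, (P.man (f z)).symm z < (P.man (f z)).symm (μ (f z)))
    (hmin : ∀ z ∈ V, ∀ i, (P.man i).symm z < (P.man i).symm (μ i) →
      (P.woman z).symm (f z) ≤ (P.woman z).symm i)
    (hmap : ∀ z ∈ V, μ (f z) ∈ V) : False := by
  classical
  induction V using Finset.strongInduction with
  | H V ih =>
    have hsub : V.image (fun z => μ (f z)) ⊆ V := by
      intro z hz
      obtain ⟨y, hy, rfl⟩ := Finset.mem_image.1 hz
      exact hmap y hy
    by_cases himg : V.image (fun z => μ (f z)) = V
    swap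
    · exact ih _ (hsub.ssubset_of_ne himg) (hV.image _) (fun z hz => hf z (hsub hz))
        (fun z hz => hmin z (hsub hz)) (fun z hz => Finset.mem_image_of_mem _ (hsub hz))
    have hinj : Set.InjOn (fun z => μ (f z)) V :=
      Finset.injOn_of_card_image_eq (congrArg Finset.card himg)
    set τ : Fin n → Fin n := fun z => if z ∈ V then f z else μ.symm z with hτ
    have hτi : Function.Injective τ := by
      intro z z' hzz
      by_cases hz : z ∈ V <;> by_cases hz' : z' ∈ V <;> simp only [hτ, hz, hz', if_true, if_false]
        at hzz
      · exact hinj hz hz' (congrArg μ hzz)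
      · exact absurd (by simpa [hzz] using hmap z hz) hz'
      · exact absurd (by simpa [← hzz] using hmap z' hz') hz
      · exact μ.symm.injective hzz
    set ν : Fin n ≃ Fin n :=
      (Equiv.ofBijective τ (Finite.injective_iff_bijective.1 hτi)).symm with hν
    have hντ : ∀ z, ν (τ z) = z := fun z => by
      rw [hν, Equiv.symm_apply_eq]; rfl
    have hle : ∀ i, (P.man i).symm (ν i) ≤ (P.man i).symm (μ i) := by
      intro i
      obtain ⟨z, rfl⟩ := (Finite.injective_iff_surjective.1 hτi) i
      rw [hντ]
      by_cases hz : z ∈ V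
      · simpa [hτ, hz] using (hf z hz).le
      · simp [hτ, hz]
    have hst : Stable P ν := by
      intro i j hij
      change (P.woman j).symm (τ j) < _
      by_cases hj : j ∈ V
      · refine lt_of_le_of_ne ?_ fun heq => ?_
        · simpa [hτ, hj] using hmin j hj i (hij.trans_le (hle i))
        · rw [← (P.woman j).symm.injective heq, hντ] at hij
          exact lt_irrefl _ hij
      · simpa [hτ, hj] using h.1 i j (hij.trans_le (hle i))
    obtain ⟨z, hz⟩ := hV
    have h1 := h.2 ν hst (τ z)
    rw [hντ] at h1
    simp only [hτ, hz, if_true] at h1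
    exact absurd (hf z hz) (not_lt.2 h1)

/-- Each woman of `V` has a favorite among her admirers, the men who prefer her to their partners. -/
theorem exists_favorite_admirer (P : Profile n) (μ : Fin n ≃ Fin n) (V : Finset (Fin n))
    (hV : ∀ z ∈ V, ∃ i, (P.man i).symm z < (P.man i).symm (μ i)) :
    ∃ f : Fin n → Fin n, ∀ z ∈ V, (P.man (f z)).symm z < (P.man (f z)).symm (μ (f z)) ∧
      ∀ i, (P.man i).symm z < (P.man i).symm (μ i) →
        (P.woman z).symm (f z) ≤ (P.woman z).symm i := by
  classical
  have : ∀ z, ∃ a, z ∈ V → (P.man a).symm z < (P.man a).symm (μ a) ∧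
      ∀ i, (P.man i).symm z < (P.man i).symm (μ i) →
        (P.woman z).symm a ≤ (P.woman z).symm i := by
    intro z
    by_cases hz : z ∈ V
    · obtain ⟨i, hi⟩ := hV z hz
      obtain ⟨a, ha, hmin⟩ := Finset.exists_min_image
        (Finset.univ.filter fun i => (P.man i).symm z < (P.man i).symm (μ i))
        (fun i => (P.woman z).symm i) ⟨i, by simpa using hi⟩
      exact ⟨a, fun _ => ⟨by simpa using ha, fun i hi => hmin i (by simpa using hi)⟩⟩
    · exact ⟨z, fun h => absurd h hz⟩
  choose f hf using this
  exact ⟨f, hf⟩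

/-- The blocking lemma: if some men strictly prefer the matching `σ` to the man-optimal stable
matching, then `σ` is blocked by a man `i` who does not and the `σ`-partner of a man `k` who does. -/
theorem ManOptimal.exists_blocking {P : Profile n} {μ σ : Fin n ≃ Fin n} (h : ManOptimal P μ)
    {k : Fin n} (hk : (P.man k).symm (σ k) < (P.man k).symm (μ k)) :
    ∃ i k, (P.man i).symm (μ i) ≤ (P.man i).symm (σ i) ∧
      (P.man k).symm (σ k) < (P.man k).symm (μ k) ∧
      (P.man i).symm (σ k) < (P.man i).symm (σ i) ∧
      (P.woman (σ k)).symm i < (P.woman (σ k)).symm k := by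
  classical
  by_contra! hcon
  set M := Finset.univ.filter fun i => (P.man i).symm (σ i) < (P.man i).symm (μ i) with hM
  have hMmem : ∀ i, i ∈ M ↔ (P.man i).symm (σ i) < (P.man i).symm (μ i) := by simp [hM]
  have hsub : M.image σ ⊆ M.image μ := by
    intro j hj
    obtain ⟨k, hk, rfl⟩ := Finset.mem_image.1 hj
    rw [hMmem] at hk
    by_contra hnot
    have hi : μ.symm (σ k) ∉ M := fun hi => hnot (by simpa using Finset.mem_image_of_mem μ hi)
    rw [hMmem, not_lt] at hi
    have hne : μ.symm (σ k) ≠ k := fun he => by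
      rw [Equiv.symm_apply_eq] at he
      exact lt_irrefl _ (he ▸ hk)
    refine absurd (h.1 k (σ k) hk) (not_lt.2 (hcon _ k hi hk ?_))
    refine lt_of_le_of_ne (by simpa using hi) fun he => hne ?_
    exact (σ.injective ((P.man _).symm.injective he)).symm
  have heq : M.image σ = M.image μ := by
    refine Finset.eq_of_subset_of_card_le hsub ?_
    rw [Finset.card_image_of_injective _ μ.injective, Finset.card_image_of_injective _ σ.injective]
  have hadm : ∀ z ∈ M.image σ, ∃ i, (P.man i).symm z < (P.man i).symm (μ i) := by
    intro z hz
    obtain ⟨k, hk, rfl⟩ := Finset.mem_image.1 hz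
    exact ⟨k, (hMmem k).1 hk⟩
  obtain ⟨f, hf⟩ := exists_favorite_admirer P μ _ hadm
  refine h.no_rotation f (M.image σ) (Finset.Nonempty.image ⟨k, (hMmem k).2 hk⟩ _)
    (fun z hz => (hf z hz).1) (fun z hz => (hf z hz).2) fun z hz => ?_
  rw [heq]
  refine Finset.mem_image_of_mem _ ?_
  by_contra hnot
  have hnot' := hnot
  rw [hMmem, not_lt] at hnot'
  obtain ⟨k, hk, rfl⟩ := Finset.mem_image.1 hz
  have h1 := hcon (f (σ k)) k hnot' ((hMmem k).1 hk) ((hf _ hz).1.trans_le hnot')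
  have h2 := le_antisymm h1 ((hf _ hz).2 k ((hMmem k).1 hk))
  exact hnot ((P.woman (σ k)).symm.injective h2 ▸ hk)

/-- Deferred acceptance is strategyproof for the men. -/
theorem ManOptimal.strategyproof {P Q : Profile n} {μ σ : Fin n ≃ Fin n} {m : Fin n}
    (h : ManOptimal P μ) (hσ : Stable Q σ) (hman : ∀ i, i ≠ m → Q.man i = P.man i)
    (hwoman : Q.woman = P.woman) : (P.man m).symm (μ m) ≤ (P.man m).symm (σ m) := by
  by_contra! hlt
  obtain ⟨i, k, hi, -, h1, h2⟩ := h.exists_blocking hlt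
  have hne : i ≠ m := fun he => absurd hlt (not_lt.2 (he ▸ hi))
  have h3 := hσ i (σ k)
  rw [hman i hne, hwoman, Equiv.symm_apply_apply] at h3
  exact lt_asymm h2 (h3 h1)

/-- The join of two stable matchings: there is a stable matching in which every woman has the better
and every man has the worse of the two partners. -/
theorem Stable.exists_join {P : Profile n} {μ ν : Fin n ≃ Fin n} (hμ : Stable P μ)
    (hν : Stable P ν) : ∃ J : Fin n ≃ Fin n, Stable P J ∧ (∀ i, J i = μ i ∨ J i = ν i) ∧
      (∀ j, (P.woman j).symm (J.symm j) ≤ (P.woman j).symm (μ.symm j)) ∧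
      (∀ j, (P.woman j).symm (J.symm j) ≤ (P.woman j).symm (ν.symm j)) := by
  set τ : Fin n → Fin n := fun j =>
    if (P.woman j).symm (μ.symm j) ≤ (P.woman j).symm (ν.symm j) then μ.symm j else ν.symm j with hτ
  have hτm : ∀ j, τ j = μ.symm j ∨ τ j = ν.symm j := fun j => by
    simp only [hτ]; split_ifs <;> simp
  have hτ1 : ∀ j, (P.woman j).symm (τ j) ≤ (P.woman j).symm (μ.symm j) := fun j => by
    simp only [hτ]; split_ifs with h
    · exact le_rfl
    · exact (not_le.1 h).le
  have hτ2 : ∀ j, (P.woman j).symm (τ j) ≤ (P.woman j).symm (ν.symm j) := fun j => by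
    simp only [hτ]; split_ifs with h
    · exact h
    · exact le_rfl
  -- the partner of `τ j` in either matching is at least as good for him as `j`
  have key1 : ∀ j, (P.man (τ j)).symm (μ (τ j)) ≤ (P.man (τ j)).symm j := fun j =>
    not_lt.1 fun h => absurd (hμ _ _ h) (not_lt.2 (hτ1 j))
  have key2 : ∀ j, (P.man (τ j)).symm (ν (τ j)) ≤ (P.man (τ j)).symm j := fun j =>
    not_lt.1 fun h => absurd (hν _ _ h) (not_lt.2 (hτ2 j))
  have hτi : Function.Injective τ := by
    intro j j' hjj
    have h1 := key1 j
    have h2 := key2 j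
    have h3 := key1 j'
    have h4 := key2 j'
    rw [← hjj] at h3 h4
    refine (P.man (τ j)).symm.injective ?_
    rcases hτm j with h | h <;> rcases hτm j' with h' | h'
    · rw [← hjj] at h'
      rw [← μ.apply_symm_apply j, ← h, ← μ.apply_symm_apply j', ← h']
    · rw [← hjj] at h'
      have e1 : μ (τ j) = j := by simp [h]
      have e2 : ν (τ j) = j' := by simp [h']
      rw [e1] at h3
      rw [e2] at h2
      exact le_antisymm h3 h2
    · rw [← hjj] at h'
      have e1 : ν (τ j) = j := by simp [h]
      have e2 : μ (τ j) = j' := by simp [h']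
      rw [e1] at h4
      rw [e2] at h1
      exact le_antisymm h4 h1
    · rw [← hjj] at h'
      rw [← ν.apply_symm_apply j, ← h, ← ν.apply_symm_apply j', ← h']
  set J : Fin n ≃ Fin n :=
    (Equiv.ofBijective τ (Finite.injective_iff_bijective.1 hτi)).symm with hJ
  have hJs : ∀ j, J.symm j = τ j := fun j => rfl
  have hJτ : ∀ j, J (τ j) = j := fun j => by rw [← hJs, Equiv.apply_symm_apply]
  refine ⟨J, ?_, ?_, hτ1, hτ2⟩
  · intro i j hij
    rw [hJs]
    have hi := hJs (J i)
    rw [Equiv.symm_apply_apply] at hi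
    rcases hτm (J i) with h | h
    · have : μ i = J i := ((Equiv.eq_symm_apply μ).1 (hi.trans h))
      exact (hτ1 j).trans_lt (hμ i j (this ▸ hij))
    · have : ν i = J i := ((Equiv.eq_symm_apply ν).1 (hi.trans h))
      exact (hτ2 j).trans_lt (hν i j (this ▸ hij))
  · intro i
    have hi := hJs (J i)
    rw [Equiv.symm_apply_apply] at hi
    rcases hτm (J i) with h | h
    · left; rw [h] at hi; rw [← Equiv.symm_apply_eq, ← hi]
    · right; rw [h] at hi; rw [← Equiv.symm_apply_eq, ← hi]

end StableMarriage

namespace StableMarriage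

variable {n : ℕ}

/-! ### Simple pair manipulations suffice -/

/-- The list `L` starts with `x`, followed by `y` (just with `x` if `x = y`). -/
def StartsWith (L : PrefList n) (x y : Fin n) : Prop :=
  (∀ z, L.symm x ≤ L.symm z) ∧ ∀ z, z ≠ x → L.symm y ≤ L.symm z

/-- A pair manipulation without regret that improves the partner of `w` does not change the partner
of `m`: otherwise the blocking lemma gives a blocking pair that contains neither `m` nor `w`. -/
theorem NoRegret.partner_eq {P : Profile n} {m w : Fin n} {Lm Lw : PrefList n}
    (h : NoRegret P m w Lm Lw)
    (hw : (P.woman w).symm ((DA (P.misreport m w Lm Lw)).symm w) <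
      (P.woman w).symm ((DA P).symm w)) : DA (P.misreport m w Lm Lw) m = DA P m := by
  refine h.resolve_left fun hlt => ?_
  obtain ⟨i, k, hi, hk, h1, h2⟩ := (DA_manOptimal P).exists_blocking hlt
  set σ := DA (P.misreport m w Lm Lw) with hσ
  have him : i ≠ m := fun he => absurd hlt (not_lt.2 (he ▸ hi))
  by_cases hkw : σ k = w
  · have h3 := (DA_manOptimal P).1 k (σ k) hk
    have hk' : σ.symm w = k := by rw [← hkw, Equiv.symm_apply_apply]
    rw [hk'] at hw
    rw [hkw] at h3
    exact lt_asymm h3 hw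
  · have h3 := (DA_manOptimal (P.misreport m w Lm Lw)).1 i (σ k)
    simp only [Profile.misreport, Function.update_of_ne him, Function.update_of_ne hkw] at h3
    have h4 := h3 h1
    change (P.woman (σ k)).symm (σ.symm (σ k)) < _ at h4
    rw [Equiv.symm_apply_apply] at h4
    exact lt_asymm h2 h4

/-- Man `m` can replace his list by one that starts with a suitable woman `x`, followed by his
partner, without changing the partners of `m` and `w`. For each `x` that `m` lists above his partner,
by strategyproofness the simple list leaves him his partner; the join of the outcomes over all these
`x` is the original matching, so that `w` has her partner already for some `x`. -/
theorem exists_simple_man_list (Q : Profile n) (m w : Fin n) (L : Fin n → PrefList n)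
    (hL : ∀ x, StartsWith (L x) x (DA Q m)) :
    ∃ x, DA { Q with man := Function.update Q.man m (L x) } m = DA Q m ∧
      (DA { Q with man := Function.update Q.man m (L x) }).symm w = (DA Q).symm w := by
  classical
  set μ := DA Q with hμdef
  set a := μ m with ha
  set b := μ.symm w with hb
  set R : Fin n → Profile n := fun x => { Q with man := Function.update Q.man m (L x) } with hR
  have hRm : ∀ x, (R x).man m = L x := fun x => by simp [hR]
  have hRi : ∀ x i, i ≠ m → (R x).man i = Q.man i := fun x i hi => by simp [hR, hi]
  have hRw : ∀ x, (R x).woman = Q.woman := fun x => rfl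
  have hμ : ManOptimal Q μ := DA_manOptimal Q
  have hν : ∀ x, ManOptimal (R x) (DA (R x)) := fun x => DA_manOptimal _
  set S : Finset (Fin n) :=
    Finset.univ.filter fun x => (Q.man m).symm x ≤ (Q.man m).symm a with hS
  have hSmem : ∀ x, x ∈ S ↔ (Q.man m).symm x ≤ (Q.man m).symm a := fun x => by simp [hS]
  have hSlt : ∀ x ∈ S, x ≠ a → (Q.man m).symm x < (Q.man m).symm a := fun x hx hxa =>
    lt_of_le_of_ne ((hSmem x).1 hx) fun h => hxa ((Q.man m).symm.injective h)
  have hpartner : ∀ x ∈ S, DA (R x) m = a := by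
    intro x hx
    have h1 := (hν x).strategyproof hμ.1 (fun i hi => (hRi x i hi).symm) (hRw x).symm
    have h2 := hμ.strategyproof (hν x).1 (hRi x) (hRw x)
    rw [hRm, ← ha] at h1
    rw [← ha] at h2
    by_cases hx1 : DA (R x) m = x
    · rw [hx1] at h2 ⊢
      exact (Q.man m).symm.injective (le_antisymm ((hSmem x).1 hx) h2)
    · exact (L x).symm.injective (le_antisymm h1 ((hL x).2 _ hx1))
  have hμR : ∀ x ∈ S, Stable (R x) μ := by
    intro x hx i j hij
    by_cases hi : i = m
    · subst hi
      rw [hRm, ← ha] at hij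
      have hjx : j = x := by_contra fun hjx => absurd hij (not_lt.2 ((hL x).2 j hjx))
      subst hjx
      exact hμ.1 _ _ (hSlt _ hx fun h => lt_irrefl _ (h ▸ hij))
    · rw [hRi x i hi] at hij
      exact hμ.1 i j hij
  have hstable : ∀ {P : Profile n} {σ : Fin n ≃ Fin n}, (∀ i, i ≠ m → P.man i = Q.man i) →
      P.woman = Q.woman → Stable P σ → σ m = a → Stable (R a) σ := by
    intro P σ hm hw' hσ hσm i j hij
    by_cases hi : i = m
    · subst hi
      rw [hRm, hσm] at hij
      exact absurd hij (not_lt.2 ((hL a).1 j))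
    · rw [hRi a i hi, ← hm i hi] at hij
      rw [hRw, ← hw']
      exact hσ i j hij
  have haS : a ∈ S := (hSmem a).2 le_rfl
  have hle : ∀ x ∈ S, ∀ i, i ≠ m → (Q.man i).symm (DA (R x) i) ≤ (Q.man i).symm (μ i) := by
    intro x hx i hi
    have := (hν x).2 μ (hμR x hx) i
    rwa [hRi x i hi] at this
  suffices ∃ x ∈ S, (DA (R x)).symm w = b by
    obtain ⟨x, hx, h⟩ := this
    exact ⟨x, hpartner x hx, h⟩
  by_cases hbm : b = m
  · refine ⟨a, haS, ?_⟩
    have : w = a := by rw [ha, ← hbm, hb, Equiv.apply_symm_apply]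
    rw [Equiv.symm_apply_eq, hbm, hpartner a haS, this]
  by_contra! hcon
  -- the join of the outcomes for the women of `T`
  have key : ∀ T ⊆ S, ∃ J : Fin n ≃ Fin n, Stable (R a) J ∧ J m = a ∧ J b ≠ w ∧
      (∀ i, i ≠ m → (Q.man i).symm (J i) ≤ (Q.man i).symm (μ i)) ∧
      ∀ x ∈ T, x ≠ a → (Q.woman x).symm (J.symm x) < (Q.woman x).symm m := by
    intro T
    induction T using Finset.induction_on with
    | empty =>
      intro _
      refine ⟨DA (R a), (hν a).1, hpartner a haS, fun h => hcon a haS ?_, hle a haS, by simp⟩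
      rw [← h, Equiv.symm_apply_apply]
    | insert x T hxT ih =>
      intro hT
      have hx : x ∈ S := hT (Finset.mem_insert_self _ _)
      obtain ⟨J, hJ, hJm, hJb, hJle, hJT⟩ := ih ((Finset.subset_insert _ _).trans hT)
      have hxst : Stable (R a) (DA (R x)) := hstable (hRi x) (hRw x) (hν x).1 (hpartner x hx)
      obtain ⟨J', hJ', hor, hj1, hj2⟩ := hJ.exists_join hxst
      refine ⟨J', hJ', ?_, ?_, ?_, ?_⟩
      · rcases hor m with h | h
        · rw [h, hJm]
        · rw [h, hpartner x hx]
      · rcases hor b with h | h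
        · rwa [h]
        · rw [h]
          intro hw
          exact hcon x hx (by rw [← hw, Equiv.symm_apply_apply])
      · intro i hi
        rcases hor i with h | h
        · rw [h]; exact hJle i hi
        · rw [h]; exact hle x hx i hi
      · intro y hy hya
        rcases Finset.mem_insert.1 hy with rfl | hy
        · refine (hj2 y).trans_lt ?_
          have := (hν y).1 m y
          rw [hRm, hpartner y hx, hRw] at this
          refine this (lt_of_le_of_ne ((hL y).1 a) fun h => hya ((L y).symm.injective h))
        · exact (hj1 y).trans_lt (hJT y hy hya)
  obtain ⟨J, hJ, hJm, hJb, hJle, hJS⟩ := key S subset_rfl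
  have hJQ : Stable Q J := by
    intro i j hij
    by_cases hi : i = m
    · subst hi
      rw [hJm] at hij
      exact hJS j ((hSmem j).2 hij.le) fun h => lt_irrefl _ (h ▸ hij)
    · have := hJ i j
      rw [hRi a i hi] at this
      exact this hij
  have h1 := (Q.man b).symm.injective (le_antisymm (hJle b hbm) (hμ.2 J hJQ b))
  rw [h1, hb, Equiv.apply_symm_apply] at hJb
  exact hJb rfl

/-- Woman `w` can replace her list by any list that starts with her partner, followed by a suitable
man `c`, without changing the outcome. Here `c` is her favorite among the men who prefer `w` to
their partners: were the new outcome different, its favorite admirers would give a rotation. -/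
theorem exists_simple_woman_list (Q : Profile n) (w : Fin n) :
    ∃ c, ∀ Q' : Profile n, Q'.man = Q.man → (∀ j, j ≠ w → Q'.woman j = Q.woman j) →
      StartsWith (Q'.woman w) ((DA Q).symm w) c → DA Q' = DA Q := by
  classical
  set μ := DA Q with hμdef
  have hμ : ManOptimal Q μ := DA_manOptimal Q
  obtain ⟨f, hf⟩ := exists_favorite_admirer Q μ
    (Finset.univ.filter fun z => ∃ i, (Q.man i).symm z < (Q.man i).symm (μ i)) (by simp)
  simp only [Finset.mem_filter, Finset.mem_univ, true_and] at hf
  refine ⟨f w, fun Q' hman hwoman hst => ?_⟩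
  set ν := DA Q' with hνdef
  have hν : ManOptimal Q' ν := DA_manOptimal Q'
  have hμ' : Stable Q' μ := by
    intro i j hij
    rw [hman] at hij
    by_cases hj : j = w
    · subst hj
      refine lt_of_le_of_ne (hst.1 i) fun h => ?_
      have := (Q'.woman j).symm.injective h
      rw [← this, Equiv.apply_symm_apply] at hij
      exact lt_irrefl _ hij
    · rw [hwoman j hj]
      exact hμ.1 i j hij
  have hle : ∀ i, (Q.man i).symm (ν i) ≤ (Q.man i).symm (μ i) := fun i => by
    rw [← hman]; exact hν.2 μ hμ' i
  by_contra hne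
  obtain ⟨d, hd⟩ : ∃ d, ν d ≠ μ d := by
    by_contra! h
    exact hne (Equiv.ext h)
  have hlt : ∀ i, ν i ≠ μ i → (Q.man i).symm (ν i) < (Q.man i).symm (μ i) := fun i hi =>
    lt_of_le_of_ne (hle i) fun h => hi ((Q.man i).symm.injective h)
  set D := Finset.univ.filter fun i => ν i ≠ μ i with hD
  have hDmem : ∀ i, i ∈ D ↔ ν i ≠ μ i := fun i => by simp [hD]
  have hV : ∀ z ∈ D.image ν, ∃ i, (Q.man i).symm z < (Q.man i).symm (μ i) := by
    intro z hz
    obtain ⟨k, hk, rfl⟩ := Finset.mem_image.1 hz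
    exact ⟨k, hlt k ((hDmem k).1 hk)⟩
  refine hμ.no_rotation f (D.image ν) (Finset.Nonempty.image ⟨d, (hDmem d).2 hd⟩ _)
    (fun z hz => (hf z (hV z hz)).1) (fun z hz => (hf z (hV z hz)).2) fun z hz => ?_
  have hfz := hf z (hV z hz)
  obtain ⟨k, hk, rfl⟩ := Finset.mem_image.1 hz
  rw [hDmem] at hk
  have hfD : ν (f (ν k)) ≠ μ (f (ν k)) := by
    intro heq
    have h1 := hν.1 (f (ν k)) (ν k)
    rw [hman, heq, Equiv.symm_apply_apply] at h1
    have h2 := h1 hfz.1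
    by_cases hw : ν k = w
    · rw [hw] at h2
      refine absurd h2 (not_lt.2 (hst.2 k fun h => hk ?_))
      rw [hw, h, Equiv.apply_symm_apply]
    · rw [hwoman _ hw] at h2
      exact absurd h2 (not_lt.2 (hfz.2 k (hlt k hk)))
  rw [Finset.mem_image]
  refine ⟨ν.symm (μ (f (ν k))), (hDmem _).2 fun h => hfD ?_, Equiv.apply_symm_apply _ _⟩
  rw [Equiv.apply_symm_apply] at h
  have h3 := μ.injective h
  exact (Equiv.eq_symm_apply ν).1 h3

/-- The partners of `m` and `w` in any outcome can be obtained with simple lists. -/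
theorem exists_simple_lists (P : Profile n) (m w : Fin n) (Lm Lw : PrefList n)
    (L : Fin n → Fin n → PrefList n) (hL : ∀ x y, StartsWith (L x y) x y) :
    ∃ x b c, DA (P.misreport m w (L x (DA (P.misreport m w Lm Lw) m)) (L b c)) m =
        DA (P.misreport m w Lm Lw) m ∧
      (DA (P.misreport m w (L x (DA (P.misreport m w Lm Lw) m)) (L b c))).symm w =
        (DA (P.misreport m w Lm Lw)).symm w := by
  set a := DA (P.misreport m w Lm Lw) m with ha
  obtain ⟨x, hx1, hx2⟩ := exists_simple_man_list (P.misreport m w Lm Lw) m w (fun x => L x a)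
    (fun x => hL x a)
  have hmis : ({ P.misreport m w Lm Lw with
      man := Function.update (P.misreport m w Lm Lw).man m (L x a) } : Profile n) =
      P.misreport m w (L x a) Lw := by
    simp [Profile.misreport]
  rw [hmis] at hx1 hx2
  obtain ⟨c, hc⟩ := exists_simple_woman_list (P.misreport m w (L x a) Lw) w
  refine ⟨x, (DA (P.misreport m w (L x a) Lw)).symm w, c, ?_⟩
  set b := (DA (P.misreport m w (L x a) Lw)).symm w
  rw [hc (P.misreport m w (L x a) (L b c)) rfl (fun j hj => by simp [Profile.misreport, hj])
    (by simpa [Profile.misreport] using hL b c)]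
  exact ⟨hx1, hx2⟩

/-- An optimal pair manipulation can be found among the simple ones. -/
theorem isOptimalPairManipulation_of_forall_simple {P : Profile n} {m w : Fin n}
    {Lm Lw : PrefList n} (L : Fin n → Fin n → PrefList n) (hL : ∀ x y, StartsWith (L x y) x y)
    (hm : DA (P.misreport m w Lm Lw) m = DA P m)
    (hbest : ∀ x b c, DA (P.misreport m w (L x (DA P m)) (L b c)) m = DA P m →
      (P.woman w).symm ((DA (P.misreport m w Lm Lw)).symm w) ≤
        (P.woman w).symm ((DA (P.misreport m w (L x (DA P m)) (L b c))).symm w)) :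
    IsOptimalPairManipulation P m w Lm Lw := by
  have hall : ∀ Lm' Lw', DA (P.misreport m w Lm' Lw') m = DA P m →
      (P.woman w).symm ((DA (P.misreport m w Lm Lw)).symm w) ≤
        (P.woman w).symm ((DA (P.misreport m w Lm' Lw')).symm w) := by
    intro Lm' Lw' h
    obtain ⟨x, b, c, h1, h2⟩ := exists_simple_lists P m w Lm' Lw' L hL
    rw [h] at h1 h2
    rw [← h2]
    exact hbest x b c h1
  have htruth : P.misreport m w (P.man m) (P.woman w) = P := by simp [Profile.misreport]
  refine ⟨hm, fun Lm' Lw' hreg hlt => ?_⟩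
  have hlt' : _ < _ := hlt
  have h0 := hall (P.man m) (P.woman w) (by rw [htruth])
  rw [htruth] at h0
  exact absurd hlt' (not_lt.2 (hall Lm' Lw' (hreg.partner_eq (hlt'.trans_le h0))))

/-- Some simple pair manipulation lets `m` keep his partner. -/
theorem exists_simple_partner_eq (P : Profile n) (m w : Fin n) (L : Fin n → Fin n → PrefList n)
    (hL : ∀ x y, StartsWith (L x y) x y) :
    ∃ x b c, DA (P.misreport m w (L x (DA P m)) (L b c)) m = DA P m := by
  have htruth : P.misreport m w (P.man m) (P.woman w) = P := by simp [Profile.misreport]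
  obtain ⟨x, b, c, h, -⟩ := exists_simple_lists P m w (P.man m) (P.woman w) L hL
  rw [htruth] at h
  exact ⟨x, b, c, h⟩

end StableMarriage

namespace StableMarriage

variable {n : ℕ}

/-! ### Sequential deferred acceptance -/

/-- Invariant of deferred acceptance with one proposal at a time. `N k` is the number of proposals
made by man `k` so far, and `H j` is `k + 1` if woman `j` holds man `k`, and `0` if she holds
nobody. -/
structure SeqInv (Q : Profile n) (N H : ℕ → ℕ) : Prop where
  le : ∀ k : Fin n, N k ≤ n
  held_le : ∀ j : Fin n, H j ≤ n
  held : ∀ k j : Fin n, H j = k + 1 → N k = (Q.man k).symm j + 1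
  better : ∀ k j : Fin n, ((Q.man k).symm j : ℕ) < N k → H j ≠ k + 1 →
    ∃ k' : Fin n, H j = k' + 1 ∧ (Q.woman j).symm k' < (Q.woman j).symm k
  unstable : ∀ k j : Fin n, ((Q.man k).symm j : ℕ) < N k → H j ≠ k + 1 →
    ∀ ν, Stable Q ν → ν k ≠ j

theorem SeqInv.eq_of_held {Q : Profile n} {N H : ℕ → ℕ} (h : SeqInv Q N H) {k j j' : Fin n}
    (hj : H j = k + 1) (hj' : H j' = k + 1) : j = j' := by
  have h1 := h.held k j hj
  have h2 := h.held k j' hj'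
  exact (Q.man k).symm.injective (Fin.ext (by omega))

theorem SeqInv.exists_of_ne_zero {Q : Profile n} {N H : ℕ → ℕ} (h : SeqInv Q N H) {j : Fin n}
    (hj : H j ≠ 0) : ∃ k : Fin n, H j = k + 1 := by
  have := h.held_le j
  exact ⟨⟨H j - 1, by omega⟩, by simp only; omega⟩

/-- A man who is not held has not yet proposed to everybody. -/
theorem SeqInv.lt_of_not_held {Q : Profile n} {N H : ℕ → ℕ} (h : SeqInv Q N H) {k : Fin n}
    (hk : ∀ j : Fin n, H j ≠ k + 1) : N k < n := by
  refine lt_of_le_of_ne (h.le k) fun hN => ?_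
  have hall : ∀ j : Fin n, ∃ k' : Fin n, H j = k' + 1 := fun j =>
    let ⟨k', hk', _⟩ := h.better k j (by rw [hN]; exact ((Q.man k).symm j).2) (hk j)
    ⟨k', hk'⟩
  choose g hg using hall
  have hgi : Function.Injective g := fun j j' hjj => h.eq_of_held (hg j) (hjj ▸ hg j')
  obtain ⟨j, hj⟩ := Finite.injective_iff_surjective.1 hgi k
  exact hk j (hj ▸ hg j)

/-- If `j` has turned down `l`, holding a man `k` who has proposed to every woman above her, then no
stable matching pairs `l` with `j`. -/
theorem ne_of_proposed_above {Q : Profile n} {k l j : Fin n}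
    (hlt : (Q.woman j).symm k < (Q.woman j).symm l)
    (habove : ∀ j', (Q.man k).symm j' < (Q.man k).symm j → ∀ ν, Stable Q ν → ν k ≠ j')
    (ν : Fin n ≃ Fin n) (hν : Stable Q ν) : ν l ≠ j := by
  intro heq
  have hne : k ≠ l := fun h => lt_irrefl _ (h ▸ hlt)
  have h1 : (Q.man k).symm j < (Q.man k).symm (ν k) := by
    refine lt_of_le_of_ne (not_lt.1 fun h => habove _ h ν hν rfl) fun h => hne ?_
    exact ν.injective (heq ▸ ((Q.man k).symm.injective h).symm)
  have h2 := hν k j h1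
  rw [← heq, Equiv.symm_apply_apply, heq] at h2
  exact lt_asymm h2 hlt

/-- The woman `j` to whom `k` proposes accepts, since she holds nobody or a man she likes less. -/
theorem SeqInv.accept {Q : Profile n} {N H : ℕ → ℕ} (h : SeqInv Q N H) {k j : Fin n}
    (hk : ∀ j : Fin n, H j ≠ k + 1) (hj : N k = (Q.man k).symm j)
    (hbetter : ∀ k' : Fin n, H j = k' + 1 → (Q.woman j).symm k < (Q.woman j).symm k') :
    SeqInv Q (Function.update N k (N k + 1)) (Function.update H j (k + 1)) := by
  have hN : ∀ l : Fin n, l ≠ k → Function.update N k (N k + 1) l = N l := fun l hl => by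
    rw [Function.update_of_ne (fun h => hl (Fin.ext h))]
  have hH : ∀ i : Fin n, i ≠ j → Function.update H j (k + 1 : ℕ) i = H i := fun l hl => by
    rw [Function.update_of_ne (fun h => hl (Fin.ext h))]
  have hlt := h.lt_of_not_held hk
  have habove : ∀ j', (Q.man k).symm j' < (Q.man k).symm j → ∀ ν, Stable Q ν → ν k ≠ j' :=
    fun j' hj' => h.unstable k j' (by rw [hj]; exact hj') (hk j')
  refine ⟨fun l => ?_, fun i => ?_, fun l i hi => ?_, fun l i hl hi => ?_, fun l i hl hi => ?_⟩
  · by_cases hl : l = k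
    · subst hl; simp; omega
    · rw [hN l hl]; exact h.le l
  · by_cases hij : i = j
    · subst hij; simp
    · rw [hH i hij]; exact h.held_le i
  · by_cases hij : i = j
    · subst hij
      have : l = k := by simp only [Function.update_self] at hi; exact Fin.ext (by omega)
      subst this
      simp [hj]
    · rw [hH i hij] at hi
      have : l ≠ k := fun he => hk i (he ▸ hi)
      rw [hN l this]
      exact h.held l i hi
  · by_cases hij : i = j
    · subst hij
      have hlk : l ≠ k := fun he => hi (by simp [he])
      rw [hN l hlk] at hl
      refine ⟨k, by simp, ?_⟩
      by_cases hli : H i = l + 1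
      · exact hbetter l hli
      · obtain ⟨k', hk', hlt'⟩ := h.better l i hl hli
        exact (hbetter k' hk').trans hlt'
    · rw [hH i hij] at hi ⊢
      refine h.better l i ?_ hi
      by_cases hlk : l = k
      · subst hlk
        simp only [Function.update_self] at hl
        refine lt_of_le_of_ne (by omega) fun he => hij ?_
        exact (Q.man l).symm.injective (Fin.ext (by omega))
      · rwa [hN l hlk] at hl
  · by_cases hij : i = j
    · subst hij
      have hlk : l ≠ k := fun he => hi (by simp [he])
      rw [hN l hlk] at hl
      by_cases hli : H i = l + 1
      · exact ne_of_proposed_above (hbetter l hli) habove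
      · exact h.unstable l i hl hli
    · rw [hH i hij] at hi
      refine h.unstable l i ?_ hi
      by_cases hlk : l = k
      · subst hlk
        simp only [Function.update_self] at hl
        refine lt_of_le_of_ne (by omega) fun he => hij ?_
        exact (Q.man l).symm.injective (Fin.ext (by omega))
      · rwa [hN l hlk] at hl

/-- The woman `j` to whom `k` proposes refuses, since she holds a man `k'` whom she likes more. -/
theorem SeqInv.refuse {Q : Profile n} {N H : ℕ → ℕ} (h : SeqInv Q N H) {k k' j : Fin n}
    (hk : ∀ j : Fin n, H j ≠ k + 1) (hj : N k = (Q.man k).symm j) (hk' : H j = k' + 1)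
    (hbetter : (Q.woman j).symm k' < (Q.woman j).symm k) :
    SeqInv Q (Function.update N k (N k + 1)) H := by
  have hN : ∀ l : Fin n, l ≠ k → Function.update N k (N k + 1) l = N l := fun l hl => by
    rw [Function.update_of_ne (fun h => hl (Fin.ext h))]
  have hlt := h.lt_of_not_held hk
  have hcase : ∀ l i : Fin n, ((Q.man l).symm i : ℕ) < Function.update N k (N k + 1) l →
      (((Q.man l).symm i : ℕ) < N l) ∨ (l = k ∧ i = j) := by
    intro l i hl
    by_cases hlk : l = k
    · subst hlk
      simp only [Function.update_self] at hl
      rcases Nat.lt_succ_iff_lt_or_eq.1 hl with h1 | h1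
      · exact Or.inl h1
      · exact Or.inr ⟨rfl, (Q.man l).symm.injective (Fin.ext (by omega))⟩
    · exact Or.inl (by rwa [hN l hlk] at hl)
  refine ⟨fun l => ?_, h.held_le, fun l i hi => ?_, fun l i hl hi => ?_, fun l i hl hi => ?_⟩
  · by_cases hl : l = k
    · subst hl; simp; omega
    · rw [hN l hl]; exact h.le l
  · rw [hN l fun he => hk i (he ▸ hi)]
    exact h.held l i hi
  · rcases hcase l i hl with h1 | ⟨rfl, rfl⟩
    · exact h.better l i h1 hi
    · exact ⟨k', hk', hbetter⟩
  · rcases hcase l i hl with h1 | ⟨rfl, rfl⟩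
    · exact h.unstable l i h1 hi
    · refine ne_of_proposed_above hbetter fun j' hj' => h.unstable k' j' ?_ fun he => ?_
      · rw [h.held k' i hk']; exact Nat.lt_succ_of_lt hj'
      · exact absurd (h.eq_of_held he hk' ▸ hj') (lt_irrefl _)

/-- When every man is held, the matching is that of deferred acceptance. -/
theorem SeqInv.eq_DA {Q : Profile n} {N H : ℕ → ℕ} (h : SeqInv Q N H)
    (hall : ∀ k : Fin n, ∃ j : Fin n, H j = k + 1) (k : Fin n) :
    H (DA Q k) = k + 1 ∧ N k = (Q.man k).symm (DA Q k) + 1 := by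
  choose g hg using hall
  have hgi : Function.Injective g := by
    intro k k' hkk
    have h1 := hg k
    have h2 := hg k'
    rw [hkk] at h1
    exact Fin.ext (by omega)
  set μ := Equiv.ofBijective g (Finite.injective_iff_bijective.1 hgi) with hμ
  have hgμ : ∀ k, H (μ k) = k + 1 := hg
  have hopt : ManOptimal Q μ := by
    have habove : ∀ i j, (Q.man i).symm j < (Q.man i).symm (μ i) →
        ((Q.man i).symm j : ℕ) < N i ∧ H j ≠ i + 1 := by
      intro i j hij
      refine ⟨?_, fun he => ?_⟩
      · rw [h.held i _ (hgμ i)]; exact Nat.lt_succ_of_lt hij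
      · exact absurd (h.eq_of_held he (hgμ i) ▸ hij) (lt_irrefl _)
    refine ⟨fun i j hij => ?_, fun ν hν i => not_lt.1 fun hij => ?_⟩
    · obtain ⟨k', hk', hlt⟩ := h.better i j (habove i j hij).1 (habove i j hij).2
      have h2 := hgμ (μ.symm j)
      rw [Equiv.apply_symm_apply, hk'] at h2
      rwa [← (Fin.ext (by omega) : k' = μ.symm j)]
    · exact h.unstable i _ (habove i _ hij).1 (habove i _ hij).2 ν hν rfl
  rw [hopt.eq_DA]
  exact ⟨hgμ k, h.held k _ (hgμ k)⟩

/-! ### Lists with given first two entries -/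

/-- The list that starts with `x`, followed by `y` (just with `x` if `x = y`), obtained from the
list `0, 1, …, n - 1` by at most two exchanges. -/
def topTwo [NeZero n] (x y : Fin n) : PrefList n :=
  if x = y then Equiv.swap 0 x else Equiv.swap 0 x * Equiv.swap 1 (Equiv.swap 0 x y)

theorem startsWith_topTwo [NeZero n] (x y : Fin n) : StartsWith (topTwo x y) x y := by
  unfold topTwo StartsWith
  split_ifs with h
  · subst h
    simp
  · have hn : 1 < n := by
      by_contra hn
      exact h (Fin.ext (by omega))
    have h01 : (0 : Fin n) ≠ 1 := by
      intro h
      have := congrArg Fin.val h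
      simp [Nat.mod_eq_of_lt hn] at this
    have hsx : (Equiv.swap 0 x * Equiv.swap 1 (Equiv.swap 0 x y)).symm x = 0 := by
      rw [Equiv.symm_apply_eq, Equiv.Perm.mul_apply, Equiv.swap_apply_of_ne_of_ne h01,
        Equiv.swap_apply_left]
      intro h0
      have := congrArg (Equiv.swap 0 x) h0
      simp only [Equiv.swap_apply_left, Equiv.swap_apply_self] at this
      exact h this
    have hsy : (Equiv.swap 0 x * Equiv.swap 1 (Equiv.swap 0 x y)).symm y = 1 := by
      rw [Equiv.symm_apply_eq, Equiv.Perm.mul_apply, Equiv.swap_apply_left, Equiv.swap_apply_self]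
    refine ⟨fun z => by rw [hsx]; exact Fin.zero_le _, fun z hz => ?_⟩
    rw [hsy]
    have : (Equiv.swap 0 x * Equiv.swap 1 (Equiv.swap 0 x y)).symm z ≠ 0 := by
      exact fun h0 => hz (Equiv.injective _ (h0.trans hsx.symm))
    have h0 := Fin.val_ne_zero_iff.2 this
    rw [Fin.le_def, show ((1 : Fin n) : ℕ) = 1 from Nat.mod_eq_of_lt hn]
    omega

end StableMarriage

/-! ### Reasoning about word RAM programs -/

namespace WordRAM

/-- Started in state `s` on words below `B`, the program `p` halts after at most `T` steps in a state
with property `Q`. -/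
def Runs (B : ℕ) (p : Prog) (s : State) (T : ℕ) (Q : State → Prop) : Prop :=
  ∃ t s', Exec B p s t s' ∧ t ≤ T ∧ Q s'

/-- The instruction `i` writes into register `r`. -/
def Instr.writesReg : Instr → ℕ → Bool
  | .const x _, r | .copy x _, r | .add x _ _, r | .sub x _ _, r | .mul x _ _, r
  | .load x _ _, r => r == x
  | .store _ _ _, _ => false

/-- The instruction `i` writes into array `a`. -/
def Instr.writesMem : Instr → ℕ → Bool
  | .store b _ _, a => a == b
  | _, _ => false

/-- Some instruction of the program writes into register `r`. -/
def Prog.writesReg : Prog → ℕ → Bool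
  | .skip, _ => false
  | .instr i, r => i.writesReg r
  | .seq p q, r | .branch _ p q, r => p.writesReg r || q.writesReg r
  | .loop _ p, r => p.writesReg r

/-- Some instruction of the program writes into array `a`. -/
def Prog.writesMem : Prog → ℕ → Bool
  | .skip, _ => false
  | .instr i, a => i.writesMem a
  | .seq p q, a | .branch _ p q, a => p.writesMem a || q.writesMem a
  | .loop _ p, a => p.writesMem a

/-- The states `s` and `s'` differ only in registers and arrays into which `p` writes. -/
structure Frame (p : Prog) (s s' : State) : Prop where
  reg : ∀ r, p.writesReg r = false → s'.reg r = s.reg r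
  mem : ∀ a, p.writesMem a = false → s'.mem a = s.mem a

theorem Frame.refl (p : Prog) (s : State) : Frame p s s := ⟨fun _ _ => rfl, fun _ _ => rfl⟩

theorem Frame.trans {p : Prog} {s s' s'' : State} (h : Frame p s s') (h' : Frame p s' s'') :
    Frame p s s'' :=
  ⟨fun r hr => (h'.reg r hr).trans (h.reg r hr), fun a ha => (h'.mem a ha).trans (h.mem a ha)⟩

theorem Frame.mono {p q : Prog} {s s' : State} (h : Frame p s s')
    (hr : ∀ r, q.writesReg r = false → p.writesReg r = false)
    (hm : ∀ a, q.writesMem a = false → p.writesMem a = false) : Frame q s s' :=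
  ⟨fun r hr' => h.reg r (hr r hr'), fun a ha => h.mem a (hm a ha)⟩

theorem Exec.frame {B : ℕ} {p : Prog} {s s' : State} {t : ℕ} (h : Exec B p s t s') :
    Frame p s s' := by
  induction h with
  | skip s => exact Frame.refl _ _
  | instr i s h =>
    constructor
    · intro r hr
      cases i <;> simp_all [Prog.writesReg, Instr.writesReg, Instr.exec, State.setReg, State.setMem]
    · intro a ha
      cases i <;> simp_all [Prog.writesMem, Instr.writesMem, Instr.exec, State.setReg, State.setMem]
  | seq hp hq ihp ihq =>
    exact (ihp.mono (by simp +contextual [Prog.writesReg])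
      (by simp +contextual [Prog.writesMem])).trans
      (ihq.mono (by simp +contextual [Prog.writesReg]) (by simp +contextual [Prog.writesMem]))
  | branch_true hb hp ih | branch_false hb hp ih =>
    exact ih.mono (by simp +contextual [Prog.writesReg]) (by simp +contextual [Prog.writesMem])
  | loop_true hb hp hl ihp ihl =>
    exact Frame.trans (p := .loop _ _) (ihp.mono (fun _ h => h) (fun _ h => h)) ihl
  | loop_false hb => exact Frame.refl _ _

variable {B : ℕ} {p q : Prog} {s : State} {T T' : ℕ} {Q Q' : State → Prop}

theorem Runs.mono (h : Runs B p s T Q) (hT : T ≤ T') (hQ : ∀ s', Frame p s s' → Q s' → Q' s') :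
    Runs B p s T' Q' :=
  let ⟨t, s', he, ht, hq⟩ := h
  ⟨t, s', he, ht.trans hT, hQ s' he.frame hq⟩

theorem Runs.seq {R : State → Prop} (h : Runs B p s T R)
    (h' : ∀ s', Frame p s s' → R s' → Runs B q s' T' Q) : Runs B (.seq p q) s (T + T') Q := by
  obtain ⟨t, s', he, ht, hr⟩ := h
  obtain ⟨t', s'', he', ht', hq⟩ := h' s' he.frame hr
  exact ⟨_, _, he.seq he', add_le_add ht ht', hq⟩

theorem Runs.skip (h : Q s) : Runs B .skip s 0 Q := ⟨0, s, .skip s, le_rfl, h⟩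

theorem Runs.branch {b : Test} (h : b.Holds s → Runs B p s T Q) (h' : ¬ b.Holds s → Runs B q s T Q) :
    Runs B (.branch b p q) s (T + 1) Q := by
  by_cases hb : b.Holds s
  · obtain ⟨t, s', he, ht, hq⟩ := h hb
    exact ⟨_, _, .branch_true hb he, Nat.succ_le_succ ht, hq⟩
  · obtain ⟨t, s', he, ht, hq⟩ := h' hb
    exact ⟨_, _, .branch_false hb he, Nat.succ_le_succ ht, hq⟩

/-- A loop with invariant `I` whose body decreases the measure `M`. -/
theorem Runs.loop {b : Test} (I : State → Prop) (M : State → ℕ)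
    (hbody : ∀ s, I s → b.Holds s → Runs B p s T fun s' => I s' ∧ M s' < M s) (hs : I s) :
    Runs B (.loop b p) s (M s * (T + 1) + 1) fun s' => I s' ∧ ¬ b.Holds s' := by
  induction hM : M s using Nat.strong_induction_on generalizing s with
  | _ k ih =>
    subst hM
    by_cases hb : b.Holds s
    · obtain ⟨t, s', he, ht, hI, hlt⟩ := hbody s hs hb
      obtain ⟨t', s'', he', ht', hq⟩ := ih _ hlt hI rfl
      refine ⟨_, _, .loop_true hb he he', ?_, hq⟩
      have : (M s' + 1) * (T + 1) ≤ M s * (T + 1) := Nat.mul_le_mul_right _ hlt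
      rw [Nat.add_mul] at this
      omega
    · exact ⟨1, s, .loop_false hb, by omega, hs, hb⟩

/-- A sequence of instructions. -/
def block : List Instr → Prog
  | [] => .skip
  | i :: l => .seq (.instr i) (block l)

/-- The state after executing a sequence of instructions. -/
def execBlock : List Instr → State → State
  | [], s => s
  | i :: l, s => execBlock l (i.exec s)

/-- All results of a sequence of instructions are below `B`. -/
def BlockFits (B : ℕ) : List Instr → State → Prop
  | [], _ => True
  | i :: l, s => i.result s < B ∧ BlockFits B l (i.exec s)

theorem Runs.block {l : List Instr} (h : BlockFits B l s) (hQ : Q (execBlock l s)) :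
    Runs B (block l) s l.length Q := by
  induction l generalizing s with
  | nil => exact Runs.skip hQ
  | cons i l ih =>
    obtain ⟨t, s', he, ht, hq⟩ := ih h.2 hQ
    exact ⟨_, _, (Exec.instr i s h.1).seq he, by simp only [List.length_cons]; omega, hq⟩

/-- The loop `for r := 0, …, n - 1 do p`, where register `0` holds `n` and register `3` holds `1`. -/
def forUp (r : ℕ) (p : Prog) : Prog :=
  .seq (.instr (.const r 0)) (.loop (.lt r 0) (.seq p (.instr (.add r r 3))))

theorem Runs.forUp {n r : ℕ} (I : ℕ → State → Prop) (h0 : s.reg 0 = n) (h3 : s.reg 3 = 1)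
    (hr0 : r ≠ 0) (hr3 : r ≠ 3) (hp0 : p.writesReg 0 = false) (hp3 : p.writesReg 3 = false)
    (hpr : p.writesReg r = false) (hB : n < B) (hinit : I 0 (s.setReg r 0))
    (hbody : ∀ k < n, ∀ s₁, Frame (forUp r p) s s₁ → s₁.reg r = k → I k s₁ →
      Runs B p s₁ T fun s₂ => I (k + 1) (s₂.setReg r (k + 1))) :
    Runs B (forUp r p) s (n * (T + 2) + 2) (I n) := by
  have hw0 : (WordRAM.forUp r p).writesReg 0 = false := by
    simp [WordRAM.forUp, Prog.writesReg, Instr.writesReg, hp0, hr0.symm]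
  have hw3 : (WordRAM.forUp r p).writesReg 3 = false := by
    simp [WordRAM.forUp, Prog.writesReg, Instr.writesReg, hp3, hr3.symm]
  have hset : ∀ (s₁ : State) (v : ℕ), Frame (WordRAM.forUp r p) s₁ (s₁.setReg r v) := by
    intro s₁ v
    refine ⟨fun x hx => ?_, fun _ _ => rfl⟩
    have : x ≠ r := by
      rintro rfl
      simp [WordRAM.forUp, Prog.writesReg, Instr.writesReg] at hx
    simp [State.setReg, this]
  have hloop := Runs.loop (B := B) (b := .lt r 0) (p := .seq p (.instr (.add r r 3)))
    (T := T + 1) (s := s.setReg r 0)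
    (fun s₁ => Frame (WordRAM.forUp r p) s s₁ ∧ s₁.reg r ≤ n ∧ I (s₁.reg r) s₁)
    (fun s₁ => n - s₁.reg r) ?_ ⟨hset _ _, by simp [State.setReg], by simpa [State.setReg]⟩
  · obtain ⟨t, s', he, ht, ⟨hf, hle, hI⟩, hnot⟩ := hloop
    refine ⟨_, _, (Exec.instr (.const r 0) s ?_).seq he, ?_, ?_⟩
    · simp only [Instr.result]; omega
    · simp only [State.setReg, Function.update_self, Nat.sub_zero] at ht
      rw [show T + 1 + 1 = T + 2 from rfl] at ht
      omega
    · simp only [Test.Holds, hf.reg 0 hw0, h0] at hnot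
      rwa [le_antisymm hle (not_lt.1 hnot)] at hI
  · rintro s₁ ⟨hf, hle, hI⟩ hb
    simp only [Test.Holds, hf.reg 0 hw0, h0] at hb
    refine (hbody _ hb s₁ hf rfl hI).seq fun s₂ hf₂ hI₂ => ?_
    have hr : s₂.reg r = s₁.reg r := hf₂.reg r hpr
    have h3' : s₂.reg 3 = 1 := by rw [hf₂.reg 3 hp3, hf.reg 3 hw3, h3]
    have hexec : (Instr.add r r 3).exec s₂ = s₂.setReg r (s₁.reg r + 1) := by
      simp [Instr.exec, Instr.result, hr, h3']
    refine ⟨1, _, Exec.instr _ s₂ ?_, le_rfl, ?_⟩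
    · simp only [Instr.result, hr, h3']; omega
    · rw [hexec]
      have hreg : (s₂.setReg r (s₁.reg r + 1)).reg r = s₁.reg r + 1 := by simp [State.setReg]
      beta_reduce
      rw [hreg]
      refine ⟨⟨(hf.trans (hf₂.mono ?_ ?_)).trans (hset _ _), hb, hI₂⟩, by omega⟩
      · intro x hx; simp_all [WordRAM.forUp, Prog.writesReg]
      · intro x hx; simp_all [WordRAM.forUp, Prog.writesMem]

end WordRAM

/-! ### Arrays and rows of arrays -/

namespace WordRAM

/-- Copies `n` cells of array `src`, starting at the cell given by register `rs`, to array `dst`,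
starting at the cell given by register `rb`. -/
def copyRow (dst src rb rs : ℕ) : Prog :=
  forUp 12 (block [.add 13 rs 12, .load 14 src 13, .add 13 rb 12, .store dst 13 14])

/-- Writes the inverse of a permutation of `0, …, n - 1`. The permutation is given by `n` cells of
array `src`, starting at the cell given by register `rs`; its inverse is written to array `dst`,
starting at the cell given by register `rb`. -/
def invertRow (dst src rb rs : ℕ) : Prog :=
  forUp 12 (block [.add 13 rs 12, .load 13 src 13, .add 13 rb 13, .store dst 13 12])

/-- Writes a list into array `a` that starts with the content of register `x`, followed by the content
of register `y`: the list `StableMarriage.topTwo`. -/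
def topTwoProg (a x y : ℕ) : Prog :=
  .seq (forUp 12 (block [.store a 12 12]))
    (.seq (block [.store a 4 x, .store a x 4])
      (.branch (.eq x y) .skip (block [.load 13 a y, .load 14 a 3, .store a 13 14, .store a 3 y])))

/-- Registers `0`, `3` and `4` hold `n`, `1` and `0`. -/
structure Consts (n : ℕ) (s : State) : Prop where
  size : s.reg 0 = n
  one : s.reg 3 = 1
  zero : s.reg 4 = 0

theorem Consts.of_frame {n : ℕ} {p : Prog} {s s' : State} (h : Consts n s) (hf : Frame p s s')
    (hp : p.writesReg 0 = false ∧ p.writesReg 3 = false ∧ p.writesReg 4 = false) : Consts n s' :=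
  ⟨by rw [hf.reg 0 hp.1, h.size], by rw [hf.reg 3 hp.2.1, h.one], by rw [hf.reg 4 hp.2.2, h.zero]⟩

variable {n B : ℕ} {s : State}

theorem runs_copyRow (hs : Consts n s) {dst src rb rs β ρ : ℕ} (hds : src ≠ dst) (hb : rb < 12)
    (hr : rs < 12) (hβ : s.reg rb = β) (hρ : s.reg rs = ρ) (hB : n < B) (hβB : β + n ≤ B)
    (hρB : ρ + n ≤ B) (hval : ∀ k < n, s.mem src (ρ + k) < B) :
    Runs B (copyRow dst src rb rs) s (n * (4 + 2) + 2) fun s' =>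
      (∀ k < n, s'.mem dst (β + k) = s.mem src (ρ + k)) ∧
      ∀ c, (∀ k < n, c ≠ β + k) → s'.mem dst c = s.mem dst c := by
  have hb12 : rb ≠ 12 := by omega
  have hr12 : rs ≠ 12 := by omega
  have hb13 : rb ≠ 13 := by omega
  have hb14 : rb ≠ 14 := by omega
  have hr13 : rs ≠ 13 := by omega
  have hr14 : rs ≠ 14 := by omega
  refine Runs.forUp (fun k s' => (∀ l < k, s'.mem dst (β + l) = s.mem src (ρ + l)) ∧
      ∀ c, (∀ l < k, c ≠ β + l) → s'.mem dst c = s.mem dst c) hs.size hs.one (by decide)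
    (by decide) rfl rfl rfl hB ⟨by simp, by simp [State.setReg]⟩ ?_
  rintro k hk s₁ hf h12 ⟨h1, h2⟩
  have hb1 : s₁.reg rb = β := by
    rw [hf.reg rb (by simp [forUp, block, Prog.writesReg, Instr.writesReg, hb12, hb13, hb14]), hβ]
  have hr1 : s₁.reg rs = ρ := by
    rw [hf.reg rs (by simp [forUp, block, Prog.writesReg, Instr.writesReg, hr12, hr13, hr14]), hρ]
  have hm1 : s₁.mem src = s.mem src :=
    hf.mem src (by simp [forUp, block, Prog.writesMem, Instr.writesMem, hds])
  have hv := hval k hk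
  refine Runs.block ?_ ?_
  · simp [BlockFits, Instr.result, Instr.exec, State.setReg, hb13, hb14, hb1, hr1, h12, hm1]
    omega
  · simp only [execBlock, Instr.result, Instr.exec, State.setReg, State.setMem,
      Function.update_apply, hb13, hb14, hb1, hr1, h12, hm1]
    simp
    constructor
    · intro l hl
      by_cases hlk : l = k
      · simp [hlk]
      · simp [hlk, h1 l (by omega)]
    · intro c hc
      rw [Function.update_of_ne (hc k (by omega)), h2 c fun l hl => hc l (by omega)]

theorem runs_invertRow (hs : Consts n s) {dst src rb rs β ρ : ℕ} (L : Equiv.Perm (Fin n))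
    (hds : src ≠ dst) (hb : rb ≠ 12 ∧ rb ≠ 13) (hr : rs ≠ 12 ∧ rs ≠ 13) (hβ : s.reg rb = β)
    (hρ : s.reg rs = ρ) (hB : n < B) (hβB : β + n ≤ B) (hρB : ρ + n ≤ B)
    (hval : ∀ k : Fin n, s.mem src (ρ + k) = L k) :
    Runs B (invertRow dst src rb rs) s (n * (4 + 2) + 2) fun s' =>
      (∀ i : Fin n, s'.mem dst (β + i) = L.symm i) ∧
      ∀ c, (∀ i : Fin n, c ≠ β + i) → s'.mem dst c = s.mem dst c := by
  obtain ⟨hb12, hb13⟩ := hb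
  obtain ⟨hr12, hr13⟩ := hr
  refine (Runs.forUp (fun k s' => (∀ l : Fin n, (l : ℕ) < k → s'.mem dst (β + L l) = l) ∧
      ∀ c, (∀ i : Fin n, c ≠ β + i) → s'.mem dst c = s.mem dst c) hs.size hs.one (by decide)
    (by decide) rfl rfl rfl hB ⟨by simp, by simp [State.setReg]⟩ ?_).mono le_rfl ?_
  · rintro k hk s₁ hf h12 ⟨h1, h2⟩
    have hb1 : s₁.reg rb = β := by
      rw [hf.reg rb (by simp [forUp, block, Prog.writesReg, Instr.writesReg, hb12, hb13]), hβ]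
    have hr1 : s₁.reg rs = ρ := by
      rw [hf.reg rs (by simp [forUp, block, Prog.writesReg, Instr.writesReg, hr12, hr13]), hρ]
    have hm1 : s₁.mem src = s.mem src :=
      hf.mem src (by simp [forUp, block, Prog.writesMem, Instr.writesMem, hds])
    have hv : s.mem src (ρ + k) = L ⟨k, hk⟩ := hval ⟨k, hk⟩
    have hlt := (L ⟨k, hk⟩).2
    refine Runs.block ?_ ?_
    · simp [BlockFits, Instr.result, Instr.exec, State.setReg, hb13, hb1, hr1, h12, hm1, hv]
      omega
    · simp only [execBlock, Instr.result, Instr.exec, State.setReg, State.setMem,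
        Function.update_apply, hb13, hb1, hr1, h12, hm1]
      simp [hv]
      constructor
      · intro l hl
        by_cases hlk : (l : ℕ) = k
        · simp [← hlk]
        · rw [Function.update_of_ne, h1 l (by omega)]
          intro h
          have := L.injective (Fin.ext (Nat.add_left_cancel h))
          exact hlk (by rw [this])
      · intro c hc
        rw [Function.update_of_ne (hc _), h2 c hc]
  · rintro s' - ⟨h1, h2⟩
    refine ⟨fun i => ?_, h2⟩
    have := h1 (L.symm i) (L.symm i).2
    rwa [Equiv.apply_symm_apply] at this

/-- Exchanging two entries of an array that holds a permutation. -/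
theorem update_update_swap {A : ℕ → ℕ} {σ : Equiv.Perm (Fin n)} (hA : ∀ k : Fin n, A k = σ k)
    (i j k : Fin n) : Function.update (Function.update A i (σ j : ℕ)) j (σ i : ℕ) k =
      (σ * Equiv.swap i j) k := by
  rw [Equiv.Perm.mul_apply]
  by_cases hj : k = j
  · subst hj; simp
  · rw [Function.update_of_ne fun h => hj (Fin.ext h)]
    by_cases hi : k = i
    · subst hi; simp
    · rw [Function.update_of_ne fun h => hi (Fin.ext h), hA,
        Equiv.swap_apply_of_ne_of_ne hi hj]

theorem runs_topTwoProg [NeZero n] (hs : Consts n s) {a rx ry : ℕ} {x y : Fin n} (hrx : rx < 12)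
    (hry : ry < 12) (hx : s.reg rx = x) (hy : s.reg ry = y) (hB : n < B) :
    Runs B (topTwoProg a rx ry) s (n * (1 + 2) + 2 + (2 + (4 + 1))) fun s' =>
      ∀ k : Fin n, s'.mem a k = StableMarriage.topTwo x y k := by
  have hn : 0 < n := Nat.pos_of_neZero n
  have hx12 : rx ≠ 12 := by omega
  have hy12 : ry ≠ 12 := by omega
  have hx13 : rx ≠ 13 := by omega
  have hy13 : ry ≠ 13 := by omega
  have hy14 : ry ≠ 14 := by omega
  refine Runs.seq (R := fun s' => ∀ k : Fin n, s'.mem a k = (1 : Equiv.Perm (Fin n)) k) ?_ ?_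
  · refine (Runs.forUp (fun k s' => ∀ l < k, s'.mem a l = l) hs.size hs.one (by decide)
      (by decide) rfl rfl rfl hB (by simp) ?_).mono le_rfl fun s' _ h k => h k k.2
    intro k hk s₁ hf h12 h1
    refine Runs.block (by simp [BlockFits, Instr.result, h12]; omega) ?_
    simp only [execBlock, Instr.result, Instr.exec, State.setReg, State.setMem,
      Function.update_self, h12]
    intro l hl
    by_cases hlk : l = k
    · simp [hlk]
    · rw [Function.update_of_ne hlk, h1 l (by omega)]
  intro s₁ hf₁ h₁
  have hs₁ : Consts n s₁ := hs.of_frame hf₁ ⟨rfl, rfl, rfl⟩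
  have hx₁ : s₁.reg rx = x := by
    rw [hf₁.reg rx (by simp [forUp, block, Prog.writesReg, Instr.writesReg, hx12]), hx]
  have hy₁ : s₁.reg ry = y := by
    rw [hf₁.reg ry (by simp [forUp, block, Prog.writesReg, Instr.writesReg, hy12]), hy]
  refine Runs.seq (R := fun s' => ∀ k : Fin n, s'.mem a k = Equiv.swap 0 x k) ?_ ?_
  · refine Runs.block ?_ ?_
    · simp [BlockFits, Instr.result, Instr.exec, State.setMem, hx₁, hs₁.zero]
      omega
    · intro k
      have := update_update_swap h₁ 0 x k
      simp only [Equiv.Perm.one_apply, Fin.val_zero, one_mul] at this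
      simp only [execBlock, Instr.result, Instr.exec, State.setMem, Function.update_self, hx₁,
        hs₁.zero, this]
  intro s₂ hf₂ h₂
  have hs₂ : Consts n s₂ := hs₁.of_frame hf₂ ⟨rfl, rfl, rfl⟩
  have hx₂ : s₂.reg rx = x := by rw [hf₂.reg rx rfl, hx₁]
  have hy₂ : s₂.reg ry = y := by rw [hf₂.reg ry rfl, hy₁]
  refine Runs.branch (fun hxy => ?_) fun hxy => ?_
  · simp only [Test.Holds, hx₂, hy₂] at hxy
    refine (Runs.skip (Q := fun s' => ∀ k : Fin n, s'.mem a k = StableMarriage.topTwo x y k)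
      fun k => ?_).mono (Nat.zero_le _) fun _ _ h => h
    rw [StableMarriage.topTwo, if_pos (Fin.ext hxy), h₂]
  · simp only [Test.Holds, hx₂, hy₂] at hxy
    have hxy' : x ≠ y := fun h => hxy (by rw [h])
    have hn1 : 1 < n := by
      by_contra hn1
      exact hxy (by omega)
    have h1v : ((1 : Fin n) : ℕ) = 1 := Nat.mod_eq_of_lt hn1
    have hA1 : s₂.mem a 1 = Equiv.swap 0 x 1 := by rw [← h₂ 1, h1v]
    have hy' := h₂ y
    refine Runs.block ?_ ?_
    · simp [BlockFits, Instr.result, Instr.exec, State.setReg, State.setMem, hy13, hy14, hy₂, hs₂.one, hy', hA1]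
      omega
    · intro k
      have := update_update_swap h₂ (Equiv.swap 0 x y) 1 k
      rw [Equiv.swap_apply_self, h1v] at this
      rw [StableMarriage.topTwo, if_neg hxy', Equiv.swap_comm 1, ← this]
      simp [execBlock, Instr.result, Instr.exec, State.setMem, State.setReg, Function.update_apply,
        hy13, hy14, hy₂, hs₂.one, hy', hA1]

end WordRAM

/-! ### Deferred acceptance on the word RAM -/

namespace StableMarriage

variable {n : ℕ}

/-- Invariant of the main loop of sequential deferred acceptance: the man `c` is about to propose, the
other men up to `i` are held, and the men above `i` are not. The loop ends with `i = c = n`. -/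
structure SeqLoopInv (Q : Profile n) (i c : ℕ) (N H : ℕ → ℕ) : Prop where
  inv : SeqInv Q N H
  le : i ≤ n
  cur_le : c ≤ i
  cur_eq : i = n → c = n
  held_iff : ∀ k : Fin n, (∃ j : Fin n, H j = k + 1) ↔ ((k : ℕ) ≤ i ∧ (k : ℕ) ≠ c)

theorem SeqLoopInv.not_held {Q : Profile n} {i : ℕ} {N H : ℕ → ℕ} {k : Fin n}
    (h : SeqLoopInv Q i k N H) (j : Fin n) : H j ≠ k + 1 :=
  fun he => ((h.held_iff k).1 ⟨j, he⟩).2 rfl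

theorem SeqLoopInv.init (Q : Profile n) {N H : ℕ → ℕ} (hN : ∀ k < n, N k = 0)
    (hH : ∀ j < n, H j = 0) : SeqLoopInv Q 0 0 N H where
  inv :=
    { le := fun k => by simp [hN k k.2]
      held_le := fun j => by simp [hH j j.2]
      held := fun k j h => by simp [hH j j.2] at h
      better := fun k j h => by simp [hN k k.2] at h
      unstable := fun k j h => by simp [hN k k.2] at h }
  le := Nat.zero_le _
  cur_le := le_rfl
  cur_eq := fun h => h
  held_iff := fun k => by
    constructor
    · rintro ⟨j, hj⟩
      simp [hH j j.2] at hj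
    · rintro ⟨h, h'⟩
      omega

/-- A woman who holds nobody accepts, and the next man enters. -/
theorem SeqLoopInv.free {Q : Profile n} {i : ℕ} {N H : ℕ → ℕ} {k j : Fin n}
    (h : SeqLoopInv Q i k N H) (hi : i < n) (hj : N k = (Q.man k).symm j) (h0 : H j = 0) :
    SeqLoopInv Q (i + 1) (i + 1) (Function.update N k (N k + 1)) (Function.update H j (k + 1)) where
  inv := h.inv.accept h.not_held hj fun k' hk' => by omega
  le := hi
  cur_le := le_rfl
  cur_eq := fun h => h
  held_iff := fun l => by
    have hc := h.cur_le
    constructor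
    · rintro ⟨j', hj'⟩
      by_cases hjj : j' = j
      · subst hjj
        simp only [Function.update_self] at hj'
        omega
      · rw [Function.update_of_ne fun h => hjj (Fin.ext h)] at hj'
        have := (h.held_iff l).1 ⟨j', hj'⟩
        omega
    · intro hl
      by_cases hlk : l = k
      · exact ⟨j, by simp [hlk]⟩
      · obtain ⟨j', hj'⟩ := (h.held_iff l).2 ⟨by omega, fun h => hlk (Fin.ext h)⟩
        refine ⟨j', ?_⟩
        rw [Function.update_of_ne fun h => ?_, hj']
        rw [h, h0] at hj'
        omega

/-- A woman who holds `k'` accepts a better man, and `k'` has to propose next. -/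
theorem SeqLoopInv.swap {Q : Profile n} {i : ℕ} {N H : ℕ → ℕ} {k k' j : Fin n}
    (h : SeqLoopInv Q i k N H) (hi : i < n) (hj : N k = (Q.man k).symm j) (hk' : H j = k' + 1)
    (hlt : (Q.woman j).symm k < (Q.woman j).symm k') :
    SeqLoopInv Q i k' (Function.update N k (N k + 1)) (Function.update H j (k + 1)) where
  inv := h.inv.accept h.not_held hj fun l hl => by
    rwa [← (Fin.ext (by omega) : k' = l)]
  le := hi.le
  cur_le := ((h.held_iff k').1 ⟨j, hk'⟩).1
  cur_eq := fun h => by omega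
  held_iff := fun l => by
    have hc := h.cur_le
    constructor
    · rintro ⟨j', hj'⟩
      by_cases hjj : j' = j
      · subst hjj
        simp only [Function.update_self] at hj'
        have : k ≠ k' := fun h => lt_irrefl _ (h ▸ hlt)
        have := fun h => this (Fin.ext h)
        omega
      · rw [Function.update_of_ne fun h => hjj (Fin.ext h)] at hj'
        refine ⟨((h.held_iff l).1 ⟨j', hj'⟩).1, fun he => hjj ?_⟩
        exact h.inv.eq_of_held (he ▸ hj') hk'
    · rintro ⟨hl, hl'⟩
      by_cases hlk : l = k
      · exact ⟨j, by simp [hlk]⟩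
      · obtain ⟨j', hj'⟩ := (h.held_iff l).2 ⟨hl, fun h => hlk (Fin.ext h)⟩
        refine ⟨j', ?_⟩
        rw [Function.update_of_ne fun h => ?_, hj']
        rw [h, hk'] at hj'
        omega

/-- A woman who holds a better man refuses. -/
theorem SeqLoopInv.refuse {Q : Profile n} {i : ℕ} {N H : ℕ → ℕ} {k k' j : Fin n}
    (h : SeqLoopInv Q i k N H) (hj : N k = (Q.man k).symm j) (hk' : H j = k' + 1)
    (hle : (Q.woman j).symm k' ≤ (Q.woman j).symm k) :
    SeqLoopInv Q i k (Function.update N k (N k + 1)) H where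
  inv := h.inv.refuse h.not_held hj hk' <| lt_of_le_of_ne hle fun he =>
    h.not_held j (by rw [hk', (Q.woman j).symm.injective he])
  le := h.le
  cur_le := h.cur_le
  cur_eq := h.cur_eq
  held_iff := h.held_iff

/-- Array `0` holds the lists of the men, and array `5` the positions of the men in the lists of the
women. -/
structure Encodes (s : WordRAM.State) (Q : Profile n) : Prop where
  man : ∀ i k : Fin n, s.mem 0 (n * i + k) = Q.man i k
  woman : ∀ j i : Fin n, s.mem 5 (n * j + i) = (Q.woman j).symm i

theorem mul_add_lt (i k : Fin n) : n * i + k < n * n :=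
  calc n * i + k < n * (i + 1) := by rw [Nat.mul_succ]; exact Nat.add_lt_add_left k.2 _
    _ ≤ n * n := Nat.mul_le_mul_left _ i.2

theorem mul_add_ne {i i' : Fin n} (h : i ≠ i') (k k' : Fin n) : n * (i : ℕ) + k ≠ n * i' + k' := by
  intro he
  refine h (Fin.ext ?_)
  have h1 := congrArg (· / n) he
  have hn : 0 < n := k.pos
  simpa [Nat.mul_add_div hn, Nat.div_eq_of_lt k.2, Nat.div_eq_of_lt k'.2] using h1

end StableMarriage

namespace WordRAM

open StableMarriage

/-- One proposal of deferred acceptance. Register `15` holds the proposing man and register `14` the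
largest man who has entered; array `7` counts the proposals of the men, and array `8` holds `k + 1`
for a woman who holds man `k`. -/
def proposeProg : Prog :=
  .seq (block [.mul 16 0 15, .load 17 7 15, .add 16 16 17, .load 18 0 16, .add 17 17 3,
      .store 7 15 17, .load 19 8 18])
    (.branch (.eq 19 4)
      (block [.add 17 15 3, .store 8 18 17, .add 14 14 3, .copy 15 14])
      (.seq (block [.sub 19 19 3, .mul 20 0 18, .add 21 20 15, .load 21 5 21, .add 22 20 19,
          .load 22 5 22])
        (.branch (.lt 21 22) (block [.add 17 15 3, .store 8 18 17, .copy 15 19]) .skip)))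

/-- Deferred acceptance with one proposal at a time. -/
def daProg : Prog :=
  .seq (forUp 12 (block [.store 7 12 4, .store 8 12 4]))
    (.seq (block [.const 14 0, .const 15 0]) (.loop (.lt 14 0) proposeProg))

variable {n B : ℕ} {s : State}

theorem runs_proposeProg {Q : Profile n} (hs : Consts n s) (hQ : Encodes s Q) (hB : n * n + n < B)
    (h : SeqLoopInv Q (s.reg 14) (s.reg 15) (s.mem 7) (s.mem 8)) (hlt : s.reg 14 < n) :
    Runs B proposeProg s 18 fun s' =>
      SeqLoopInv Q (s'.reg 14) (s'.reg 15) (s'.mem 7) (s'.mem 8) ∧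
      s'.mem 7 = Function.update (s.mem 7) (s.reg 15) (s.mem 7 (s.reg 15) + 1) ∧
      s.reg 15 < n ∧ s.mem 7 (s.reg 15) < n := by
  obtain ⟨k, hk⟩ : ∃ k : Fin n, s.reg 15 = k := ⟨⟨s.reg 15, h.cur_le.trans_lt hlt⟩, rfl⟩
  rw [hk] at h
  have hN := h.inv.lt_of_not_held h.not_held
  obtain ⟨q, hq⟩ : ∃ q : Fin n, s.mem 7 k = q := ⟨⟨_, hN⟩, rfl⟩
  obtain ⟨j, hj⟩ : ∃ j : Fin n, Q.man k q = j := ⟨_, rfl⟩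
  have hNj : s.mem 7 k = (Q.man k).symm j := by rw [hq, ← hj, Equiv.symm_apply_apply]
  have hload := hQ.man k q
  rw [hj] at hload
  have hidx := mul_add_lt k q
  have hHj := h.inv.held_le j
  refine (Runs.seq (T := 7) (T' := 11) (R := fun s₁ => s₁.reg 15 = k ∧ s₁.reg 18 = j ∧
    s₁.reg 19 = s.mem 8 j ∧ s₁.reg 14 = s.reg 14 ∧
    s₁.mem 7 = Function.update (s.mem 7) k (s.mem 7 k + 1) ∧ s₁.mem 8 = s.mem 8) ?_ ?_).mono le_rfl
    (Q := fun s' => SeqLoopInv Q (s'.reg 14) (s'.reg 15) (s'.mem 7) (s'.mem 8) ∧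
      s'.mem 7 = Function.update (s.mem 7) k (s.mem 7 k + 1)) ?_
  · refine Runs.block ?_ ?_
    · simp [BlockFits, Instr.result, Instr.exec, State.setReg, State.setMem, hs.size, hs.one,
        hk, hq, hload]
      refine ⟨?_, ?_, ?_, ?_, ?_, ?_⟩ <;> omega
    · simp [execBlock, Instr.result, Instr.exec, State.setReg, State.setMem, hs.size, hs.one,
        hk, hq, hload]
  · rintro s₁ hf₁ ⟨h15, h18, h19, h14, h7, h8⟩
    have hs₁ : Consts n s₁ := hs.of_frame hf₁ ⟨rfl, rfl, rfl⟩
    refine Runs.branch (T := 10) (fun hb => ?_) fun hb => ?_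
    · simp only [Test.Holds, h19, hs₁.zero] at hb
      refine (Runs.block (Q := fun s' => SeqLoopInv Q (s'.reg 14) (s'.reg 15) (s'.mem 7) (s'.mem 8) ∧
        s'.mem 7 = Function.update (s.mem 7) k (s.mem 7 k + 1)) ?_ ?_).mono (by simp)
          fun _ _ h => h
      · simp [BlockFits, Instr.result, Instr.exec, State.setReg, State.setMem, hs₁.one, h15, h14]
        omega
      · have := h.free hlt hNj hb
        simpa [execBlock, Instr.result, Instr.exec, State.setReg, State.setMem, hs₁.one, h15, h14,
          h18, h7, h8] using this
    · simp only [Test.Holds, h19, hs₁.zero] at hb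
      obtain ⟨k', hk'⟩ := h.inv.exists_of_ne_zero hb
      have hidx1 := mul_add_lt j k
      have hidx2 := mul_add_lt j k'
      have hl1 : s₁.mem 5 (n * j + k) = (Q.woman j).symm k := by
        rw [hf₁.mem 5 rfl, hQ.woman]
      have hl2 : s₁.mem 5 (n * j + k') = (Q.woman j).symm k' := by
        rw [hf₁.mem 5 rfl, hQ.woman]
      refine Runs.seq (T := 6) (T' := 4) (R := fun s₂ => s₂.reg 15 = k ∧ s₂.reg 18 = j ∧
        s₂.reg 19 = k' ∧ s₂.reg 14 = s.reg 14 ∧ s₂.reg 21 = (Q.woman j).symm k ∧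
        s₂.reg 22 = (Q.woman j).symm k' ∧
        s₂.mem 7 = Function.update (s.mem 7) k (s.mem 7 k + 1) ∧ s₂.mem 8 = s.mem 8) ?_ ?_
      · refine Runs.block ?_ ?_
        · simp [BlockFits, Instr.result, Instr.exec, State.setReg, hs₁.size, hs₁.one,
            h15, h18, h19, hk', hl1, hl2]
          refine ⟨?_, ?_, ?_, ?_, ?_, ?_⟩ <;> omega
        · simp [execBlock, Instr.result, Instr.exec, State.setReg, hs₁.size, hs₁.one,
            h15, h18, h19, h14, h7, h8, hk', hl1, hl2]
      · rintro s₂ hf₂ ⟨h15, h18, h19, h14, h21, h22, h7, h8⟩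
        have hs₂ : Consts n s₂ := hs₁.of_frame hf₂ ⟨rfl, rfl, rfl⟩
        refine Runs.branch (T := 3) (fun hb' => ?_) fun hb' => ?_
        · simp only [Test.Holds, h21, h22] at hb'
          refine Runs.block ?_ ?_
          · simp [BlockFits, Instr.result, Instr.exec, State.setReg, State.setMem, hs₂.one, h15,
              h19]
            omega
          · have := h.swap hlt hNj hk' hb'
            simpa [execBlock, Instr.result, Instr.exec, State.setReg, State.setMem, hs₂.one, h15,
              h14, h18, h19, h7, h8] using this
        · simp only [Test.Holds, h21, h22, not_lt] at hb'
          refine (Runs.skip (Q := fun s' =>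
            SeqLoopInv Q (s'.reg 14) (s'.reg 15) (s'.mem 7) (s'.mem 8) ∧
            s'.mem 7 = Function.update (s.mem 7) k (s.mem 7 k + 1)) ?_).mono (by simp)
              fun _ _ h => h
          rw [h15, h14, h7, h8]
          exact ⟨h.refuse hNj hk' hb', rfl⟩
  · rintro s' - ⟨h1, h2⟩
    rw [hk]
    exact ⟨h1, h2, k.2, hN⟩

theorem runs_daProg {Q : Profile n} (hs : Consts n s) (hQ : Encodes s Q)
    (hB : n * n + n < B) :
    Runs B daProg s (n * (2 + 2) + 2 + (2 + (n * n * (18 + 1) + 1))) fun s' =>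
      ∀ k : Fin n, s'.mem 8 (DA Q k) = k + 1 ∧ s'.mem 7 k = (Q.man k).symm (DA Q k) + 1 := by
  have hnB : n < B := lt_of_le_of_lt (Nat.le_add_left _ _) hB
  refine Runs.seq (R := fun s' => ∀ k < n, s'.mem 7 k = 0 ∧ s'.mem 8 k = 0) ?_ ?_
  · refine Runs.forUp (fun k s' => ∀ l < k, s'.mem 7 l = 0 ∧ s'.mem 8 l = 0) hs.size hs.one
      (by decide) (by decide) rfl rfl rfl hnB (by simp) ?_
    intro k hk s₁ hf h12 h1
    have h4 : s₁.reg 4 = 0 := by rw [hf.reg 4 rfl, hs.zero]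
    refine Runs.block ?_ ?_
    · simp [BlockFits, Instr.result, Instr.exec, State.setMem, h4]
      omega
    · intro l hl
      simp only [execBlock, Instr.result, Instr.exec, State.setReg, State.setMem, h4, h12]
      by_cases hlk : l = k
      · simp [hlk]
      · have := h1 l (by omega)
        simp [hlk, this]
  intro s₁ hf₁ h₁
  have hs₁ : Consts n s₁ := hs.of_frame hf₁ ⟨rfl, rfl, rfl⟩
  refine Runs.seq (R := fun s' => s'.reg 14 = 0 ∧ s'.reg 15 = 0 ∧
    ∀ k < n, s'.mem 7 k = 0 ∧ s'.mem 8 k = 0) ?_ ?_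
  · refine Runs.block ?_ ?_
    · simp [BlockFits, Instr.result]
      omega
    · simpa [execBlock, Instr.result, Instr.exec, State.setReg] using h₁
  rintro s₂ hf₂ ⟨h14, h15, h₂⟩
  have hs₂ : Consts n s₂ := hs₁.of_frame hf₂ ⟨rfl, rfl, rfl⟩
  have hQ₂ : Encodes s₂ Q := by
    constructor
    · rw [hf₂.mem 0 rfl, hf₁.mem 0 rfl]; exact hQ.man
    · rw [hf₂.mem 5 rfl, hf₁.mem 5 rfl]; exact hQ.woman
  have hloop := Runs.loop (B := B) (b := .lt 14 0) (p := proposeProg) (T := 18) (s := s₂)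
    (fun s' => Consts n s' ∧ Encodes s' Q ∧
      SeqLoopInv Q (s'.reg 14) (s'.reg 15) (s'.mem 7) (s'.mem 8))
    (fun s' => ∑ k : Fin n, (n - s'.mem 7 k)) ?_ ⟨hs₂, hQ₂, ?_⟩
  · refine hloop.mono ?_ ?_
    · refine Nat.succ_le_succ (Nat.mul_le_mul_right _ ?_)
      calc _ ≤ ∑ _k : Fin n, n := Finset.sum_le_sum fun k _ => Nat.sub_le _ _
        _ = n * n := by simp
    · rintro s' - ⟨⟨hs', -, hI⟩, hnot⟩ k
      simp only [Test.Holds, hs'.size, not_lt] at hnot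
      have h14 := le_antisymm hI.le hnot
      refine hI.inv.eq_DA (fun k => (hI.held_iff k).2 ?_) k
      rw [hI.cur_eq h14, h14]
      exact ⟨k.2.le, k.2.ne⟩
  · rintro s₃ ⟨hs₃, hQ₃, hI⟩ hb
    simp only [Test.Holds, hs₃.size] at hb
    refine (runs_proposeProg hs₃ hQ₃ hB hI hb).mono le_rfl ?_
    rintro s₄ hf₄ ⟨hI', h7, hc, hN⟩
    refine ⟨⟨hs₃.of_frame hf₄ ⟨rfl, rfl, rfl⟩, ⟨?_, ?_⟩, hI'⟩, ?_⟩
    · rw [hf₄.mem 0 rfl]; exact hQ₃.man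
    · rw [hf₄.mem 5 rfl]; exact hQ₃.woman
    · refine Finset.sum_lt_sum (fun k _ => ?_) ⟨⟨_, hc⟩, Finset.mem_univ _, ?_⟩
      · rw [h7, Function.update_apply]
        split_ifs with he
        · rw [he]; omega
        · exact le_rfl
      · rw [h7]
        simp only [Function.update_self]
        omega
  · rw [h14, h15]
    exact SeqLoopInv.init Q (fun k hk => (h₂ k hk).1) fun k hk => (h₂ k hk).2

end WordRAM

/-! ### Search for an optimal pair manipulation -/

namespace WordRAM

open StableMarriage

/-- Writes the partner of man `m` after deferred acceptance into register `r`, where registers `1` and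
`7` hold `m` and `n * m`. The partner is the last woman to whom `m` has
proposed. -/
def partnerProg (r : ℕ) : Prog :=
  block [.load 13 7 1, .sub 13 13 3, .add 13 7 13, .load r 0 13]

/-- Evaluates the simple lists given by `x`, `b`, `c` in registers `9`, `10`, `11`: the lists are built in
arrays `9` and `10` and entered into arrays `0` and `5` for deferred acceptance. Registers `1`, `2`,
`7`, `8` hold `m`, `w`, `n * m`, `n * w`; register `5` holds the true partner of `m`; array `6` holds the
true positions of the men in the list of `w`, and register `6` the best position found so far. -/
def candidateProg : Prog :=
  .seq (topTwoProg 9 9 5) <| .seq (topTwoProg 10 10 11) <| .seq (copyRow 0 9 7 4) <|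
  .seq (invertRow 5 10 8 4) <| .seq daProg <| .seq (partnerProg 13) <|
  .branch (.eq 13 5)
    (.seq (block [.load 13 8 2, .sub 13 13 3, .load 13 6 13])
      (.branch (.lt 13 6)
        (.seq (block [.copy 6 13]) (.seq (copyRow 2 9 4 4) (copyRow 3 10 4 4))) .skip))
    .skip

/-- Evaluates all simple lists. -/
def searchProg : Prog := forUp 9 (forUp 10 (forUp 11 candidateProg))

/-- Runs deferred acceptance on the true lists, and then evaluates all simple lists. -/
def mainProg : Prog :=
  .seq (block [.const 3 1, .mul 7 0 1, .mul 8 0 2]) <|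
  .seq (forUp 9 (.seq (block [.mul 15 0 9]) (invertRow 5 1 15 15))) <|
  .seq daProg <| .seq (partnerProg 5) <| .seq (invertRow 6 1 4 8) <|
  .seq (block [.copy 6 0]) searchProg

variable {n B : ℕ} {s : State}

theorem runs_partnerProg {Q : Profile n} {m : Fin n} {r : ℕ} (hs : Consts n s) (h1 : s.reg 1 = m)
    (h7 : s.reg 7 = n * m) (hQ : Encodes s Q) (hB : n * n + n < B)
    (hDA : ∀ k : Fin n, s.mem 7 k = (Q.man k).symm (DA Q k) + 1) :
    Runs B (partnerProg r) s 4 fun s' => s'.reg r = DA Q m := by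
  have hidx := mul_add_lt m ((Q.man m).symm (DA Q m))
  have hl := hQ.man m ((Q.man m).symm (DA Q m))
  rw [Equiv.apply_symm_apply] at hl
  refine Runs.block ?_ ?_
  · simp [BlockFits, Instr.result, Instr.exec, State.setReg, hs.one, h1, h7, hDA, hl]
    refine ⟨?_, ?_, ?_, ?_⟩ <;> omega
  · simp [execBlock, Instr.result, Instr.exec, State.setReg, hs.one, h1, h7, hDA, hl]

/-- The data that stay fixed during the search. -/
structure SearchData (P : Profile n) (m w : Fin n) (s : State) : Prop where
  consts : Consts n s
  reg1 : s.reg 1 = m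
  reg2 : s.reg 2 = w
  reg5 : s.reg 5 = DA P m
  reg7 : s.reg 7 = n * m
  reg8 : s.reg 8 = n * w
  mem6 : ∀ i : Fin n, s.mem 6 i = (P.woman w).symm i
  man : ∀ i, i ≠ m → ∀ k : Fin n, s.mem 0 (n * i + k) = P.man i k
  woman : ∀ j, j ≠ w → ∀ i : Fin n, s.mem 5 (n * j + i) = (P.woman j).symm i

theorem SearchData.setReg {P : Profile n} {m w : Fin n} (h : SearchData P m w s) {r v : ℕ}
    (hr : r = 9 ∨ r = 10 ∨ r = 11) : SearchData P m w (s.setReg r v) := by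
  rcases hr with rfl | rfl | rfl <;>
  exact ⟨⟨h.consts.size, h.consts.one, h.consts.zero⟩, h.reg1, h.reg2, h.reg5, h.reg7, h.reg8,
    h.mem6, h.man, h.woman⟩

/-- The best pair manipulation found after the lists given by `D x b c` have been evaluated. Register
`6` holds the position of its partner in the true list of `w` (`n` if none has been found), and arrays
`2` and `3` hold the two lists. -/
structure BestSoFar [NeZero n] (P : Profile n) (m w : Fin n) (D : ℕ → ℕ → ℕ → Prop) (s : State) :
    Prop where
  le : s.reg 6 ≤ n
  found : s.reg 6 < n → ∃ Lm Lw : PrefList n, HoldsList s 2 Lm ∧ HoldsList s 3 Lw ∧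
    DA (P.misreport m w Lm Lw) m = DA P m ∧
    ((P.woman w).symm ((DA (P.misreport m w Lm Lw)).symm w) : ℕ) = s.reg 6
  best : ∀ x b c : Fin n, D x b c →
    DA (P.misreport m w (topTwo x (DA P m)) (topTwo b c)) m = DA P m →
    s.reg 6 ≤ (P.woman w).symm
      ((DA (P.misreport m w (topTwo x (DA P m)) (topTwo b c))).symm w)

theorem BestSoFar.congr [NeZero n] {P : Profile n} {m w : Fin n} {D D' : ℕ → ℕ → ℕ → Prop}
    {s s' : State} (h : BestSoFar P m w D s) (h6 : s'.reg 6 = s.reg 6) (h2 : s'.mem 2 = s.mem 2)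
    (h3 : s'.mem 3 = s.mem 3) (hD : ∀ x b c : Fin n, D' x b c → D x b c) :
    BestSoFar P m w D' s' := by
  refine ⟨by rw [h6]; exact h.le, ?_, ?_⟩
  · rw [h6]
    simpa only [HoldsList, h2, h3] using h.found
  · rw [h6]
    exact fun x b c hd => h.best x b c (hD x b c hd)

/-- The triple `(x', b', c')` precedes `(x, b, c)` lexicographically. -/
def LexBefore (x b c x' b' c' : ℕ) : Prop :=
  x' < x ∨ x' = x ∧ (b' < b ∨ b' = b ∧ c' < c)

theorem runs_candidateProg [NeZero n] {P : Profile n} {m w x b c : Fin n}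
    (hs : SearchData P m w s) (hbest : BestSoFar P m w (LexBefore x b c) s) (h9 : s.reg 9 = x)
    (h10 : s.reg 10 = b) (h11 : s.reg 11 = c) (hB : n * n + n < B) :
    Runs B candidateProg s (100 * n ^ 2) fun s' =>
      SearchData P m w s' ∧ BestSoFar P m w (LexBefore x b (c + 1)) s' := by
  have hn : 0 < n := Nat.pos_of_neZero n
  have hnB : n < B := lt_of_le_of_lt (Nat.le_add_left _ _) hB
  have hmrow : n * m + n ≤ B := by
    have := Nat.mul_le_mul_left n m.2
    rw [Nat.mul_succ] at this
    omega
  have hwrow : n * w + n ≤ B := by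
    have := Nat.mul_le_mul_left n w.2
    rw [Nat.mul_succ] at this
    omega
  set Lm := topTwo x (DA P m) with hLm
  set Lw := topTwo b c with hLw
  set Q := P.misreport m w Lm Lw with hQ
  have hT : (n * (1 + 2) + 2 + (2 + (4 + 1))) + ((n * (1 + 2) + 2 + (2 + (4 + 1))) +
      ((n * (4 + 2) + 2) + ((n * (4 + 2) + 2) + ((n * (2 + 2) + 2 + (2 + (n * n * (18 + 1) + 1))) +
      (4 + ((3 + ((1 + ((n * (4 + 2) + 2) + (n * (4 + 2) + 2))) + 1)) + 1)))))) ≤ 100 * n ^ 2 := by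
    nlinarith
  refine Runs.mono ?_ hT fun _ _ h => h
  refine (runs_topTwoProg hs.consts (by decide) (by decide) h9 hs.reg5 hnB).seq fun s₁ hf₁ h₁ => ?_
  have hc₁ : Consts n s₁ := hs.consts.of_frame hf₁ ⟨rfl, rfl, rfl⟩
  refine (runs_topTwoProg hc₁ (by decide) (by decide) ((hf₁.reg 10 rfl).trans h10)
    ((hf₁.reg 11 rfl).trans h11) hnB).seq fun s₂ hf₂ h₂ => ?_
  have hc₂ : Consts n s₂ := hc₁.of_frame hf₂ ⟨rfl, rfl, rfl⟩
  have h9₂ : ∀ k : Fin n, s₂.mem 9 k = Lm k := fun k => by rw [hf₂.mem 9 rfl, h₁]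
  have h7₂ : s₂.reg 7 = n * m := by rw [hf₂.reg 7 rfl, hf₁.reg 7 rfl, hs.reg7]
  refine (runs_copyRow hc₂ (by decide) (by decide) (by decide) h7₂ hc₂.zero hnB hmrow (by omega)
    fun k hk => ?_).seq fun s₃ hf₃ h₃ => ?_
  · have := h9₂ ⟨k, hk⟩
    rw [Nat.zero_add, this]
    exact (Fin.is_lt _).trans hnB
  have hc₃ : Consts n s₃ := hc₂.of_frame hf₃ ⟨rfl, rfl, rfl⟩
  have h10₃ : ∀ k : Fin n, s₃.mem 10 k = Lw k := fun k => by rw [hf₃.mem 10 rfl, h₂]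
  have h8₃ : s₃.reg 8 = n * w := by
    rw [hf₃.reg 8 rfl, hf₂.reg 8 rfl, hf₁.reg 8 rfl, hs.reg8]
  refine (runs_invertRow hc₃ Lw (by decide) (by decide) (by decide) h8₃ hc₃.zero hnB hwrow
    (by omega) fun k => by rw [Nat.zero_add, h10₃]).seq fun s₄ hf₄ h₄ => ?_
  have hc₄ : Consts n s₄ := hc₃.of_frame hf₄ ⟨rfl, rfl, rfl⟩
  have hQ₄ : Encodes s₄ Q := by
    constructor
    · intro i k
      rw [hf₄.mem 0 rfl, hQ]
      by_cases him : i = m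
      · subst him
        rw [h₃.1 k k.2, Nat.zero_add, h9₂]
        simp [Profile.misreport]
      · rw [h₃.2 _ fun l hl => mul_add_ne him k ⟨l, hl⟩, hf₂.mem 0 rfl, hf₁.mem 0 rfl,
          hs.man i him]
        simp [Profile.misreport, him]
    · intro j i
      rw [hQ]
      by_cases hjw : j = w
      · subst hjw
        rw [h₄.1]
        simp [Profile.misreport]
      · rw [h₄.2 _ fun l => mul_add_ne hjw i l, hf₃.mem 5 rfl, hf₂.mem 5 rfl, hf₁.mem 5 rfl,
          hs.woman j hjw]
        simp [Profile.misreport, hjw]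
  refine (runs_daProg hc₄ hQ₄ hB).seq fun s₅ hf₅ h₅ => ?_
  have hc₅ : Consts n s₅ := hc₄.of_frame hf₅ ⟨rfl, rfl, rfl⟩
  have hQ₅ : Encodes s₅ Q := by
    constructor
    · rw [hf₅.mem 0 rfl]; exact hQ₄.man
    · rw [hf₅.mem 5 rfl]; exact hQ₄.woman
  -- registers below `9` and the arrays `2`, `3`, `6` have not been touched so far
  have hreg₅ : ∀ r, (r = 1 ∨ r = 2 ∨ r = 5 ∨ r = 6 ∨ r = 7 ∨ r = 8) → s₅.reg r = s.reg r := by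
    rintro r (rfl | rfl | rfl | rfl | rfl | rfl) <;>
    rw [hf₅.reg _ rfl, hf₄.reg _ rfl, hf₃.reg _ rfl, hf₂.reg _ rfl, hf₁.reg _ rfl]
  have hmem₅ : ∀ a, (a = 2 ∨ a = 3 ∨ a = 6) → s₅.mem a = s.mem a := by
    rintro a (rfl | rfl | rfl) <;>
    rw [hf₅.mem _ rfl, hf₄.mem _ rfl, hf₃.mem _ rfl, hf₂.mem _ rfl, hf₁.mem _ rfl]
  have hs₅ : SearchData P m w s₅ := by
    refine ⟨hc₅, ?_, ?_, ?_, ?_, ?_, ?_, ?_, ?_⟩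
    · rw [hreg₅ 1 (by simp), hs.reg1]
    · rw [hreg₅ 2 (by simp), hs.reg2]
    · rw [hreg₅ 5 (by simp), hs.reg5]
    · rw [hreg₅ 7 (by simp), hs.reg7]
    · rw [hreg₅ 8 (by simp), hs.reg8]
    · rw [hmem₅ 6 (by simp)]; exact hs.mem6
    · intro i him k
      rw [hQ₅.man, hQ]
      simp [Profile.misreport, him]
    · intro j hjw i
      rw [hQ₅.woman, hQ]
      simp [Profile.misreport, hjw]
  have hbest₅ : BestSoFar P m w (LexBefore x b c) s₅ :=
    hbest.congr (hreg₅ 6 (by simp)) (hmem₅ 2 (by simp)) (hmem₅ 3 (by simp)) fun _ _ _ h => h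
  -- a state in which the best lists found are at least as good as the new ones
  have hfinish : ∀ s' : State, SearchData P m w s' → BestSoFar P m w (LexBefore x b c) s' →
      (DA Q m = DA P m → s'.reg 6 ≤ (P.woman w).symm ((DA Q).symm w)) →
      SearchData P m w s' ∧ BestSoFar P m w (LexBefore x b (c + 1)) s' := by
    intro s' hs' hb' hnew
    refine ⟨hs', hb'.le, hb'.found, fun x' b' c' hd hm => ?_⟩
    by_cases hd' : LexBefore x b c x' b' c'
    · exact hb'.best x' b' c' hd' hm
    · have hx : x' = x := Fin.ext (by unfold LexBefore at hd hd'; omega)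
      have hbb : b' = b := Fin.ext (by unfold LexBefore at hd hd'; omega)
      have hcc : c' = c := Fin.ext (by unfold LexBefore at hd hd'; omega)
      subst hx hbb hcc
      exact hnew hm
  have hsame : ∀ {p : Prog} {s s' : State}, SearchData P m w s → Frame p s s' →
      p.writesReg 0 = false → p.writesReg 1 = false → p.writesReg 2 = false →
      p.writesReg 3 = false → p.writesReg 4 = false → p.writesReg 5 = false →
      p.writesReg 7 = false → p.writesReg 8 = false → p.writesMem 0 = false →
      p.writesMem 5 = false → p.writesMem 6 = false → SearchData P m w s' := by
    intro p s s' h hf h0 h1 h2 h3 h4 h5 h7 h8 h0' h5' h6'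
    exact ⟨h.consts.of_frame hf ⟨h0, h3, h4⟩, by rw [hf.reg 1 h1, h.reg1],
      by rw [hf.reg 2 h2, h.reg2], by rw [hf.reg 5 h5, h.reg5], by rw [hf.reg 7 h7, h.reg7],
      by rw [hf.reg 8 h8, h.reg8], by rw [hf.mem 6 h6']; exact h.mem6,
      by rw [hf.mem 0 h0']; exact h.man, by rw [hf.mem 5 h5']; exact h.woman⟩
  refine (runs_partnerProg hc₅ hs₅.reg1 hs₅.reg7 hQ₅ hB fun k => (h₅ k).2).seq fun s₆ hf₆ h₆ => ?_
  have hs₆ : SearchData P m w s₆ := hsame hs₅ hf₆ rfl rfl rfl rfl rfl rfl rfl rfl rfl rfl rfl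
  have hbest₆ : BestSoFar P m w (LexBefore x b c) s₆ :=
    hbest₅.congr (hf₆.reg 6 rfl) (hf₆.mem 2 rfl) (hf₆.mem 3 rfl) fun _ _ _ h => h
  refine Runs.branch (fun heq => ?_) fun hne => ?_
  swap
  · refine (Runs.skip (Q := fun s' => SearchData P m w s' ∧
      BestSoFar P m w (LexBefore x b (c + 1)) s') ?_).mono (Nat.zero_le _) fun _ _ h => h
    refine hfinish s₆ hs₆ hbest₆ fun h => absurd ?_ hne
    simp only [Test.Holds, h₆, hs₆.reg5, h]
  simp only [Test.Holds, h₆, hs₆.reg5] at heq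
  have hpartner : DA Q m = DA P m := Fin.ext heq
  set v : Fin n := (P.woman w).symm ((DA Q).symm w) with hv
  have hheld : s₆.mem 8 w = (DA Q).symm w + 1 := by
    have := (h₅ ((DA Q).symm w)).1
    rw [Equiv.apply_symm_apply] at this
    rw [hf₆.mem 8 rfl, this]
  refine Runs.seq (R := fun s' => s'.reg 13 = v) ?_ ?_
  · have h6 := hs₆.mem6 ((DA Q).symm w)
    rw [← hv] at h6
    refine Runs.block ?_ ?_
    · simp [BlockFits, Instr.result, Instr.exec, State.setReg, hs₆.reg2, hs₆.consts.one, hheld, h6]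
      refine ⟨?_, ?_, ?_⟩ <;> omega
    · simp [execBlock, Instr.result, Instr.exec, State.setReg, hs₆.reg2, hs₆.consts.one, hheld, h6]
  intro s₇ hf₇ h₇
  have hs₇ : SearchData P m w s₇ := hsame hs₆ hf₇ rfl rfl rfl rfl rfl rfl rfl rfl rfl rfl rfl
  have hbest₇ : BestSoFar P m w (LexBefore x b c) s₇ :=
    hbest₆.congr (hf₇.reg 6 rfl) (hf₇.mem 2 rfl) (hf₇.mem 3 rfl) fun _ _ _ h => h
  refine Runs.branch (fun hlt => ?_) fun hge => ?_
  swap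
  · refine (Runs.skip (Q := fun s' => SearchData P m w s' ∧
      BestSoFar P m w (LexBefore x b (c + 1)) s') ?_).mono (Nat.zero_le _) fun _ _ h => h
    simp only [Test.Holds, h₇, not_lt] at hge
    exact hfinish s₇ hs₇ hbest₇ fun _ => hge
  simp only [Test.Holds, h₇] at hlt
  refine Runs.seq (R := fun s' => s'.reg 6 = v) (Runs.block ?_ ?_) fun s₈ hf₈ h₈ => ?_
  · simp [BlockFits, Instr.result, h₇]
    omega
  · simp [execBlock, Instr.result, Instr.exec, State.setReg, h₇]
  have hs₈ : SearchData P m w s₈ := hsame hs₇ hf₈ rfl rfl rfl rfl rfl rfl rfl rfl rfl rfl rfl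
  have h9₈ : ∀ k : Fin n, s₈.mem 9 k = Lm k := fun k => by
    rw [hf₈.mem 9 rfl, hf₇.mem 9 rfl, hf₆.mem 9 rfl, hf₅.mem 9 rfl, hf₄.mem 9 rfl, hf₃.mem 9 rfl,
      h9₂]
  have h10₈ : ∀ k : Fin n, s₈.mem 10 k = Lw k := fun k => by
    rw [hf₈.mem 10 rfl, hf₇.mem 10 rfl, hf₆.mem 10 rfl, hf₅.mem 10 rfl, hf₄.mem 10 rfl, h10₃]
  refine (runs_copyRow hs₈.consts (by decide) (by decide) (by decide) hs₈.consts.zero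
    hs₈.consts.zero hnB (by omega) (by omega) fun k hk => ?_).seq fun s₉ hf₉ h₉ => ?_
  · have := h9₈ ⟨k, hk⟩
    rw [Nat.zero_add, this]
    exact (Fin.is_lt _).trans hnB
  have hs₉ : SearchData P m w s₉ := hsame hs₈ hf₉ rfl rfl rfl rfl rfl rfl rfl rfl rfl rfl rfl
  refine (runs_copyRow hs₉.consts (by decide) (by decide) (by decide) hs₉.consts.zero
    hs₉.consts.zero hnB (by omega) (by omega) fun k hk => ?_).mono le_rfl fun s' hf' h' => ?_
  · have := h10₈ ⟨k, hk⟩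
    rw [Nat.zero_add, hf₉.mem 10 rfl, this]
    exact (Fin.is_lt _).trans hnB
  have hs' : SearchData P m w s' := hsame hs₉ hf' rfl rfl rfl rfl rfl rfl rfl rfl rfl rfl rfl
  have h6' : s'.reg 6 = v := by rw [hf'.reg 6 rfl, hf₉.reg 6 rfl, h₈]
  refine hfinish s' hs' ⟨by rw [h6']; exact v.2.le, fun _ => ⟨Lm, Lw, ?_, ?_, hpartner, h6'.symm⟩,
    fun x' b' c' hd hm => ?_⟩ fun _ => h6'.le
  · intro k
    have := h₉.1 k k.2
    rw [Nat.zero_add] at this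
    rw [hf'.mem 2 rfl, this, h9₈]
  · intro k
    have := h'.1 k k.2
    rw [Nat.zero_add] at this
    rw [this, hf₉.mem 10 rfl, h10₈]
  · rw [h6']
    exact hlt.le.trans (hbest₇.best x' b' c' hd hm)

theorem forUp_time {n K d : ℕ} (hn : 0 < n) :
    n * (K * n ^ d + 2) + 2 ≤ (K + 4) * n ^ (d + 1) := by
  have h1 : 1 ≤ n ^ d := Nat.one_le_pow _ _ hn
  have h2 : n ≤ n ^ d * n := Nat.le_mul_of_pos_left _ h1
  rw [pow_succ]
  nlinarith

theorem runs_searchProg [NeZero n] {P : Profile n} {m w : Fin n} (hs : SearchData P m w s)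
    (h6 : s.reg 6 = n) (hB : n * n + n < B) :
    Runs B searchProg s (112 * n ^ 5) fun s' => BestSoFar P m w (fun _ _ _ => True) s' := by
  have hn : 0 < n := Nat.pos_of_neZero n
  have hnB : n < B := lt_of_le_of_lt (Nat.le_add_left _ _) hB
  refine (Runs.forUp (T := 108 * n ^ 4)
    (fun x s' => SearchData P m w s' ∧ BestSoFar P m w (LexBefore x 0 0) s')
    hs.consts.size hs.consts.one (by decide) (by decide) rfl rfl rfl hnB ?_ ?_).mono
    (forUp_time hn) ?_
  · refine ⟨hs.setReg (by simp), h6.le, fun h => ?_, fun x b c hd => ?_⟩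
    · simp [State.setReg, h6] at h
    · simp [LexBefore] at hd
  · rintro x hx s₁ - h9 ⟨hs₁, hb₁⟩
    refine (Runs.forUp (T := 104 * n ^ 3)
      (fun b s' => s'.reg 9 = x ∧ SearchData P m w s' ∧ BestSoFar P m w (LexBefore x b 0) s')
      hs₁.consts.size hs₁.consts.one (by decide) (by decide) rfl rfl rfl hnB ?_ ?_).mono
      (forUp_time hn) ?_
    · exact ⟨by simpa [State.setReg] using h9, hs₁.setReg (by simp),
        hb₁.congr rfl rfl rfl fun _ _ _ h => h⟩
    · rintro b hb s₂ - h10 ⟨h9, hs₂, hb₂⟩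
      refine (Runs.forUp (T := 100 * n ^ 2)
        (fun c s' => s'.reg 9 = x ∧ s'.reg 10 = b ∧ SearchData P m w s' ∧
          BestSoFar P m w (LexBefore x b c) s')
        hs₂.consts.size hs₂.consts.one (by decide) (by decide) rfl rfl rfl hnB ?_ ?_).mono
        (forUp_time hn) ?_
      · exact ⟨by simpa [State.setReg] using h9, by simpa [State.setReg] using h10,
          hs₂.setReg (by simp), hb₂.congr rfl rfl rfl fun _ _ _ h => h⟩
      · rintro c hc s₃ - h11 ⟨h9, h10, hs₃, hb₃⟩
        refine (runs_candidateProg (x := ⟨x, hx⟩) (b := ⟨b, hb⟩) (c := ⟨c, hc⟩) hs₃ hb₃ h9 h10 h11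
          hB).mono le_rfl ?_
        rintro s₄ hf₄ ⟨hs₄, hb₄⟩
        refine ⟨?_, ?_, hs₄.setReg (by simp), hb₄.congr rfl rfl rfl fun _ _ _ h => h⟩
        · simp [State.setReg, hf₄.reg 9 rfl, h9]
        · simp [State.setReg, hf₄.reg 10 rfl, h10]
      · rintro s₃ - ⟨h9, h10, hs₃, hb₃⟩
        refine ⟨by simpa [State.setReg] using h9, hs₃.setReg (by simp),
          hb₃.congr rfl rfl rfl fun x' b' c' hd => ?_⟩
        have := c'.2
        unfold LexBefore at hd ⊢
        omega
    · rintro s₂ - ⟨h9, hs₂, hb₂⟩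
      refine ⟨hs₂.setReg (by simp), hb₂.congr rfl rfl rfl fun x' b' c' hd => ?_⟩
      have := b'.2
      unfold LexBefore at hd ⊢
      omega
  · rintro s₁ - ⟨-, hb₁⟩
    exact hb₁.congr rfl rfl rfl fun x' _ _ _ => Or.inl x'.2

theorem inputState_mem_man {P : Profile n} {m w : Fin n} (i k : Fin n) :
    (inputState P m w).mem 0 (n * i + k) = P.man i k := by
  have hn : 0 < n := k.pos
  have h := mul_add_lt i k
  simp only [inputState, h, dif_pos]
  congr 2
  · congr 1
    ext
    simp [Fin.divNat, Nat.mul_add_div hn, Nat.div_eq_of_lt k.2]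
  · ext
    simp [Fin.modNat, Nat.mod_eq_of_lt k.2]

theorem inputState_mem_woman {P : Profile n} {m w : Fin n} (j k : Fin n) :
    (inputState P m w).mem 1 (n * j + k) = P.woman j k := by
  have hn : 0 < n := k.pos
  have h := mul_add_lt j k
  simp only [inputState, h, dif_pos]
  congr 2
  · congr 1
    ext
    simp [Fin.divNat, Nat.mul_add_div hn, Nat.div_eq_of_lt k.2]
  · ext
    simp [Fin.modNat, Nat.mod_eq_of_lt k.2]

theorem runs_mainProg [NeZero n] (P : Profile n) (m w : Fin n) (hB : n * n + n < B) :
    Runs B mainProg (inputState P m w) (200 * n ^ 5) fun s' =>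
      BestSoFar P m w (fun _ _ _ => True) s' := by
  have hn : 0 < n := Nat.pos_of_neZero n
  have hnB : n < B := lt_of_le_of_lt (Nat.le_add_left _ _) hB
  have hmrow := Nat.mul_le_mul_left n m.2
  have hwrow := Nat.mul_le_mul_left n w.2
  rw [Nat.mul_succ] at hmrow hwrow
  have hT : 3 + ((n * ((1 + (n * (4 + 2) + 2)) + 2) + 2) +
      ((n * (2 + 2) + 2 + (2 + (n * n * (18 + 1) + 1))) +
      (4 + ((n * (4 + 2) + 2) + (1 + 112 * n ^ 5))))) ≤ 200 * n ^ 5 := by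
    have h1 : 1 ≤ n ^ 5 := Nat.one_le_pow _ _ hn
    have h2 : n ^ 2 ≤ n ^ 5 := Nat.pow_le_pow_right hn (by norm_num)
    have h3 : n ≤ n ^ 2 := by nlinarith
    nlinarith
  refine Runs.mono ?_ hT fun _ _ h => h
  set s := inputState P m w with hs
  refine Runs.seq (R := fun s' => Consts n s' ∧ s'.reg 1 = m ∧ s'.reg 2 = w ∧ s'.reg 7 = n * m ∧
    s'.reg 8 = n * w) (Runs.block ?_ ?_) ?_
  · simp [BlockFits, Instr.result, Instr.exec, State.setReg, hs, inputState]
    refine ⟨?_, ?_, ?_⟩ <;> omega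
  · refine ⟨⟨?_, ?_, ?_⟩, ?_⟩ <;>
    simp [execBlock, Instr.result, Instr.exec, State.setReg, hs, inputState]
  rintro s₁ hf₁ ⟨hc₁, h1₁, h2₁, h7₁, h8₁⟩
  have hman₁ : ∀ i k : Fin n, s₁.mem 0 (n * i + k) = P.man i k := by
    rw [hf₁.mem 0 rfl]; exact inputState_mem_man
  have hwoman₁ : ∀ j k : Fin n, s₁.mem 1 (n * j + k) = P.woman j k := by
    rw [hf₁.mem 1 rfl]; exact inputState_mem_woman
  refine Runs.seq (R := fun s' => ∀ j : Fin n, (j : ℕ) < n →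
    ∀ i : Fin n, s'.mem 5 (n * j + i) = (P.woman j).symm i) ?_ ?_
  · refine Runs.forUp (fun j s' => ∀ j' : Fin n, (j' : ℕ) < j →
      ∀ i : Fin n, s'.mem 5 (n * j' + i) = (P.woman j').symm i) hc₁.size hc₁.one (by decide)
      (by decide) rfl rfl rfl hnB (by simp) ?_
    intro j hj s₂ hf₂ h9 h₂
    have hc₂ : Consts n s₂ := hc₁.of_frame hf₂ ⟨rfl, rfl, rfl⟩
    have hjrow := Nat.mul_le_mul_left n hj
    rw [Nat.mul_succ] at hjrow
    refine Runs.seq (R := fun s' => s'.reg 15 = n * j) (Runs.block ?_ ?_) fun s₃ hf₃ h₃ => ?_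
    · simp [BlockFits, Instr.result, hc₂.size, h9]
      omega
    · simp [execBlock, Instr.result, Instr.exec, State.setReg, hc₂.size, h9]
    have hc₃ : Consts n s₃ := hc₂.of_frame hf₃ ⟨rfl, rfl, rfl⟩
    refine (runs_invertRow hc₃ (P.woman ⟨j, hj⟩) (by decide) (by decide) (by decide) h₃ h₃ hnB
      (by omega) (by omega) fun k => ?_).mono le_rfl fun s₄ hf₄ h₄ => ?_
    · rw [hf₃.mem 1 rfl, hf₂.mem 1 rfl]
      exact hwoman₁ ⟨j, hj⟩ k
    · intro j' hj' i
      simp only [State.setReg]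
      by_cases hjj : j' = ⟨j, hj⟩
      · subst hjj
        exact h₄.1 i
      · rw [h₄.2 _ fun l => mul_add_ne hjj i l, hf₃.mem 5 rfl]
        refine h₂ j' (lt_of_le_of_ne (Nat.lt_succ_iff.1 hj') fun h => hjj (Fin.ext h)) i
  intro s₂ hf₂ h₂
  have hc₂ : Consts n s₂ := hc₁.of_frame hf₂ ⟨rfl, rfl, rfl⟩
  have hQ₂ : Encodes s₂ P := ⟨by rw [hf₂.mem 0 rfl]; exact hman₁, fun j i => h₂ j j.2 i⟩
  refine (runs_daProg hc₂ hQ₂ hB).seq fun s₃ hf₃ h₃ => ?_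
  have hc₃ : Consts n s₃ := hc₂.of_frame hf₃ ⟨rfl, rfl, rfl⟩
  have hQ₃ : Encodes s₃ P := by
    constructor
    · rw [hf₃.mem 0 rfl]; exact hQ₂.man
    · rw [hf₃.mem 5 rfl]; exact hQ₂.woman
  have h1₃ : s₃.reg 1 = m := by rw [hf₃.reg 1 rfl, hf₂.reg 1 rfl, h1₁]
  have h7₃ : s₃.reg 7 = n * m := by rw [hf₃.reg 7 rfl, hf₂.reg 7 rfl, h7₁]
  refine (runs_partnerProg hc₃ h1₃ h7₃ hQ₃ hB fun k => (h₃ k).2).seq fun s₄ hf₄ h₄ => ?_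
  have hc₄ : Consts n s₄ := hc₃.of_frame hf₄ ⟨rfl, rfl, rfl⟩
  have h8₄ : s₄.reg 8 = n * w := by
    rw [hf₄.reg 8 rfl, hf₃.reg 8 rfl, hf₂.reg 8 rfl, h8₁]
  refine (runs_invertRow hc₄ (P.woman w) (by decide) (by decide) (by decide) hc₄.zero h8₄ hnB
    (by omega) (by omega) fun k => ?_).seq fun s₅ hf₅ h₅ => ?_
  · rw [hf₄.mem 1 rfl, hf₃.mem 1 rfl, hf₂.mem 1 rfl, hwoman₁]
  have hc₅ : Consts n s₅ := hc₄.of_frame hf₅ ⟨rfl, rfl, rfl⟩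
  refine Runs.seq (R := fun s' => s'.reg 6 = n) (Runs.block ?_ ?_) fun s₆ hf₆ h₆ => ?_
  · simp [BlockFits, Instr.result, hc₅.size, hnB]
  · simp [execBlock, Instr.result, Instr.exec, State.setReg, hc₅.size]
  refine runs_searchProg ⟨hc₅.of_frame hf₆ ⟨rfl, rfl, rfl⟩, ?_, ?_, ?_, ?_, ?_, ?_, ?_, ?_⟩ h₆ hB
  · rw [hf₆.reg 1 rfl, hf₅.reg 1 rfl, hf₄.reg 1 rfl, h1₃]
  · rw [hf₆.reg 2 rfl, hf₅.reg 2 rfl, hf₄.reg 2 rfl, hf₃.reg 2 rfl, hf₂.reg 2 rfl, h2₁]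
  · rw [hf₆.reg 5 rfl, hf₅.reg 5 rfl, h₄]
  · rw [hf₆.reg 7 rfl, hf₅.reg 7 rfl, hf₄.reg 7 rfl, h7₃]
  · rw [hf₆.reg 8 rfl, hf₅.reg 8 rfl, h8₄]
  · intro i
    have := h₅.1 i
    rw [Nat.zero_add] at this
    rw [hf₆.mem 6 rfl, this]
  · intro i _ k
    rw [hf₆.mem 0 rfl, hf₅.mem 0 rfl, hf₄.mem 0 rfl, hQ₃.man]
  · intro j _ i
    rw [hf₆.mem 5 rfl, hf₅.mem 5 rfl, hf₄.mem 5 rfl, hQ₃.woman]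

end WordRAM

/-- There is a word RAM program which, on words of `O(log n)` bits, computes an optimal pair
manipulation in `O(n ^ 5)` steps, for all profiles and all pairs of a man and a woman. -/
theorem mainTheorem1 :
    ∃ (p : WordRAM.Prog) (k C : ℕ),
      ∀ (n : ℕ) (P : StableMarriage.Profile n) (m w : Fin n),
        ∃ (t : ℕ) (s : WordRAM.State) (Lm Lw : StableMarriage.PrefList n),
          WordRAM.Exec ((n + 1) ^ k) p (StableMarriage.inputState P m w) t s ∧
          t ≤ C * n ^ 5 ∧
          StableMarriage.HoldsList s 2 Lm ∧
          StableMarriage.HoldsList s 3 Lw ∧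
          StableMarriage.IsOptimalPairManipulation P m w Lm Lw := by
  refine ⟨WordRAM.mainProg, 2, 200, fun n P m w => ?_⟩
  have : NeZero n := ⟨m.pos.ne'⟩
  obtain ⟨t, s, he, ht, hbest⟩ :=
    WordRAM.runs_mainProg (B := (n + 1) ^ 2) P m w (by ring_nf; have := m.pos; omega)
  obtain ⟨x, b, c, hxbc⟩ :=
    StableMarriage.exists_simple_partner_eq P m w _ StableMarriage.startsWith_topTwo
  obtain ⟨Lm, Lw, h2, h3, hm, hval⟩ :=
    hbest.found ((hbest.best x b c trivial hxbc).trans_lt (Fin.is_lt _))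
  refine ⟨t, s, Lm, Lw, he, ht, h2, h3,
    StableMarriage.isOptimalPairManipulation_of_forall_simple _ StableMarriage.startsWith_topTwo hm
      fun x b c h => ?_⟩
  rw [Fin.le_def, hval]
  exact hbest.best x b c trivial h
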